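/- **Birkhoff's Theorem for Algebras.** Conventions. $\mathbb N=\{1,2,\dots\}$; products of families may be empty; "variety" means a class closed under homomorphic images, subalgebras and products. *Algebras.* Let $\rho=(\rho_n)_{n\ge 0}$ be a finitary type (disjoint sets $\rho_n$ of $n$-ary operation symbols) and $\rho^\star=\bigcup_n\rho_n$. A $\rho$-algebra has a non-empty carrier. $\mathrm{Th}_H$ is the set of identities between $\rho$-terms in the variables $v_1,v_2,\dots$ that hold in all members of a class $H$; $\mathrm{Mod}$ denotes the class of models. *Clone algebras.* For a set $\tau$ of symbols, a clone $\tau$-algebra is an algebra $(C,q_n,\mathsf e_i,\sigma)_{n\ge0,\,i\ge1,\,\sigma\in\tau}$ with $q_n$ of arity $n+1$ and constants $\mathsf e_i,\sigma$, such that $q_n(\mathsf e_i,x_1,\dots,x_n)=x_i$ for $i\le n$; $q_n(\mathsf e_j,x_1,\dots,x_n)=\mathsf e_j$ for $j>n$; $q_n(x,\mathsf e_1,\dots,\mathsf e_n)=x$; $q_n(x,\mathbf y)=q_k(x,\mathbf y,\mathsf e_{n+1},\dots,\mathsf e_k)$ for $k>n$; and $q_n(q_n(x,y_1,\dots,y_n),\mathbf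 z)=q_n(x,q_n(y_1,\mathbf z),\dots,q_n(y_n,\mathbf z))$. The element $a$ depends on $\mathsf e_n$ if $q_n(a,\mathsf e_1,\dots,\mathsf e_{n-1},\mathsf e_{n+1})\ne a$; $\dim(a)$ is the largest such $n$ ($0$ if there is none, $\omega$ if there are infinitely many). *t-Algebras.* For $r\in A^{\mathbb N}$ let $r[a_1,\dots,a_n]$ be $r$ with its first $n$ entries replaced by $a_1,\dots,a_n$. Write $r\equiv s$ if $r,s\in A^{\mathbb N}$ differ at finitely many places. A trace on a set $A$ is a (possibly empty) union of $\equiv$-classes; it is basic if it is one class. A t-algebra $\mathbf A=(A,\mathsf a,\sigma^{\mathbf A})_{\sigma\in\tau}$ of type $\tau$ consists of a set $A$, a trace $\mathsf a$ on $A$ and maps $\sigma^{\mathbf A}:\mathsf a\to A$. A t-subalgebra is given by $B\subseteq A$ and a trace $\mathsf b\subseteq\mathsf a$ on $B$ with $\sigma^{\mathbf A}(\mathsf b)\subseteq B$ for all $\sigma$; it is full if $B=A$, and is then denoted $\mathbf A_{\upharpoonright\mathsf b}$. A t-homomorphism $\mathbf A\to\mathbf B$ is a map $f:A\to B$ such that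 $f^{\mathbb N}$ maps $\mathsf a$ into $\mathsf b$ and $f\circ\sigma^{\mathbf A}=\sigma^{\mathbf B}\circ f^{\mathbb N}$; it is onto if $f:A\to B$ and $f^{\mathbb N}:\mathsf a\to\mathsf b$ are both onto. The t-product of $(\mathbf A_j)_{j\in J}$ has carrier $\prod_jA_j$, trace $\prod_j\mathsf a_j$ and operations $\sigma(s)=(\sigma^{\mathbf A_j}(s^j))_j$. *Functional clone algebras.* $\mathbf A^{(\mathsf a)}$ is the clone $\tau$-algebra of all maps $\mathsf a\to A$, with $\mathsf e_i(s)=s_i$, $q_n(\varphi,\psi_1,\dots,\psi_n)(s)=\varphi(s[\psi_1(s),\dots,\psi_n(s)])$ and the constants $\sigma^{\mathbf A}$. Its subalgebras are the functional clone algebras with value domain $\mathbf A$; such a subalgebra is rich if it contains all constant maps. For a class $K$ of t-algebras, $K^{\triangle}$ is the class of all clone algebras isomorphic to a functional clone algebra with value domain in $K$. For a class $V$ of clone $\tau$-algebras, $V^{\blacktriangledown}$ (resp. $V^{\triangledown}$) is the class of all t-algebras $\mathbf A$ such that some (resp. some rich) functional clone algebra with value domain $\mathbf A$ is in $V$. *Terms.*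 For a set $X$ disjoint from $\tau$, the $\tau$-hyperterms over $X$ are built up from $\mathsf e_1,\mathsf e_2,\dots$ by forming $w(t_1,\dots,t_n,\mathsf e_{n+1},\mathsf e_{n+2},\dots)$ for $w\in\tau\cup X$, $n\ge0$; with $q_n(t,u_1,\dots,u_n)$ the substitution of $u_i$ for $\mathsf e_i$ $(i\le n)$ in $t$ they form a clone $\tau$-algebra $\mathcal T_\tau(X)$, in which $w\in\tau\cup X$ is identified with $w(\mathsf e_1,\mathsf e_2,\dots)$. Hyperterms over $\emptyset$ are called terms; $t\mapsto t^{\mathbf A}$ is the unique homomorphism from $\mathcal T_\tau(\emptyset)$ to $\mathbf A^{(\mathsf a)}$. Let $\theta_K$ be the set of pairs $(t,u)$ of terms with $t^{\mathbf A}=u^{\mathbf A}$ for all $\mathbf A\in K$, and $\mathrm{Mod}(E)$ the class of t-algebras $\mathbf A$ with $t^{\mathbf A}=u^{\mathbf A}$ for all $(t,u)\in E$. A t-algebra $\mathbf A$ weakly satisfies a pair $(t,u)$ of hyperterms over $X$ if $\alpha(t)=\alpha(u)$ for every homomorphism $\alpha:\mathcal T_\tau(X)\to\mathbf A^{(\mathsf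 a)}$ that maps every $x\in X$ to a constant map; $\mathrm{Tw}^X_K$ is the set of pairs weakly satisfied by all $\mathbf A\in K$, and $\mathrm{Mod}_w(\Gamma)$ is the class of t-algebras that weakly satisfy all pairs in $\Gamma$. *Varieties of t-algebras.* A class $K$ of t-algebras of type $\tau$ is a t-variety if it is closed under t-homomorphic images, t-subalgebras and t-products. It is an Ft-variety if moreover $\mathbf A\in K$ for every t-algebra $\mathbf A$ with $\mathbf A_{\upharpoonright\mathsf d}\in K$ for all basic traces $\mathsf d\subseteq\mathsf a$. It is an Et-variety if it is a t-variety and $\mathbf A\in K$ for every t-algebra $\mathbf A$ with $\mathbf A_{\bar s}\in K$ for all $s\in\mathsf a$, where $\mathbf A_{\bar s}$ is the t-subalgebra with universe $A_{\bar s}=\{t^{\mathbf A}(s): t\text{ a term}\}$ and trace $\{r\in (A_{\bar s})^{\mathbb N}: r\equiv s\}$. *Gluing.* For a class $H$ of $\rho$-algebras, $H^\star$ is the class of all t-algebras $\mathbf A$ of type $\rho^\star$ such that $\dim(\sigma^{\mathbf A})\le n$ in $\mathbf A^{(\mathsf a)}$ for all $n$ and $\sigma\in\rho_n$, and such that for every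 basic trace $\mathsf d\subseteq\mathsf a$ there is a $\rho$-algebra $\mathbf S\in H$ with carrier $A$ and $\sigma^{\mathbf A}(s)=\sigma^{\mathbf S}(s_1,\dots,s_n)$ for all $s\in\mathsf d$, $n\ge 0$, $\sigma\in\rho_n$. **Theorem.** Let $\rho$ be a finitary type, $H$ a class of $\rho$-algebras and $X$ an infinite set disjoint from $\rho^\star$. The following are equivalent: 1. $H$ is a variety; 2. $H=\mathrm{Mod}(\mathrm{Th}_H)$; 3. $H^\star$ is an Et-variety; 4. $H^\star=\mathrm{Mod}(\theta_{H^\star})$; 5. $(H^\star)^{\triangle}$ is a variety of clone $\rho^\star$-algebras and $H^\star=(H^\star)^{\triangle\blacktriangledown}$; 6. $H^\star$ is an Ft-variety; 7. $H^\star=\mathrm{Mod}_w(\mathrm{Tw}^X_{H^\star})$; 8. $(H^\star)^{\triangle}$ is a variety of clone $\rho^\star$-algebras and $H^\star=(H^\star)^{\triangle\triangledown}$; 9. $H^\star$ is a t-variety. -/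

import Mathlib

universe u

/-! Convention: threads, variables and the elements `e` are indexed by `ℕ = {0, 1, …}`; the index `i`
stands for the `(i+1)`-st coordinate (variable, projection) in the notation counting from one. -/

/-! ### Threads and traces -/

/-- The thread `r[a₁, …, aₙ]`: the first `n` entries of `r` are replaced by `a₁, …, aₙ`. -/
def splice {A : Type u} (r : ℕ → A) {n : ℕ} (a : Fin n → A) : ℕ → A :=
  fun i => if h : i < n then a ⟨i, h⟩ else r i

/-- Two threads are equivalent if they differ at finitely many places only. -/
def ThreadEquiv {A : Type u} (r s : ℕ → A) : Prop := {i | r i ≠ s i}.Finite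

/-- A trace on `A` is a union of classes of `ThreadEquiv`. -/
def IsTrace {A : Type u} (a : Set (ℕ → A)) : Prop :=
  ∀ s ∈ a, ∀ r, ThreadEquiv r s → r ∈ a

/-- A basic trace is a single class of `ThreadEquiv`. -/
def IsBasicTrace {A : Type u} (a : Set (ℕ → A)) : Prop :=
  ∃ s, a = {r | ThreadEquiv r s}

theorem ThreadEquiv.refl {A : Type u} (s : ℕ → A) : ThreadEquiv s s := by
  simp [ThreadEquiv]

theorem ThreadEquiv.symm {A : Type u} {r s : ℕ → A} (h : ThreadEquiv r s) : ThreadEquiv s r := by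
  refine h.subset ?_
  intro i hi
  exact fun h' => hi h'.symm

theorem ThreadEquiv.trans {A : Type u} {r s t : ℕ → A} (h : ThreadEquiv r s)
    (h' : ThreadEquiv s t) : ThreadEquiv r t := by
  refine (h.union h').subset ?_
  intro i hi
  by_cases hrs : r i = s i
  · exact Or.inr (fun hst => hi (hrs.trans hst))
  · exact Or.inl hrs

theorem splice_equiv {A : Type u} (r : ℕ → A) {n : ℕ} (a : Fin n → A) :
    ThreadEquiv (splice r a) r := by
  refine (Set.finite_lt_nat n).subset ?_
  intro i hi
  by_contra h
  exact hi (by simp [splice, show ¬ i < n from h])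

theorem IsTrace.splice_mem {A : Type u} {a : Set (ℕ → A)} (ha : IsTrace a) {s : ℕ → A}
    (hs : s ∈ a) {n : ℕ} (x : Fin n → A) : splice s x ∈ a :=
  ha s hs _ (splice_equiv s x)

theorem IsBasicTrace.isTrace {A : Type u} {a : Set (ℕ → A)} (ha : IsBasicTrace a) :
    IsTrace a := by
  obtain ⟨s, rfl⟩ := ha
  intro r hr t ht
  exact ThreadEquiv.trans ht hr

/-- The members of the unique partition of the trace `a` into basic traces. -/
def basicParts {A : Type u} (a : Set (ℕ → A)) : Set (Set (ℕ → A)) :=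
  {d | IsBasicTrace d ∧ d ⊆ a}

/-- The top `a`-extension of a finitary operation. -/
def topExt {A : Type u} {n : ℕ} (f : (Fin n → A) → A) (a : Set (ℕ → A)) : a → A :=
  fun s => f (fun i => s.1 i)

/-! ### Algebras of a finitary type -/

/-- The structure of a `ρ`-algebra on a set. -/
def RhoStr (ρ : ℕ → Type u) (A : Type u) : Type u := ∀ n, ρ n → (Fin n → A) → A

/-- `ρ`-algebras, where `ρ n` is the set of operation symbols of arity `n`; as usual in universal
algebra the carrier is non-empty. -/
structure RhoAlg (ρ : ℕ → Type u) : Type (u + 1) where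
  carrier : Type u
  nonempty : Nonempty carrier
  op : RhoStr ρ carrier

namespace RhoAlg

variable {ρ : ℕ → Type u}

/-- Homomorphisms of `ρ`-algebras. -/
def IsHom (S T : RhoAlg ρ) (f : S.carrier → T.carrier) : Prop :=
  ∀ n (σ : ρ n) (x : Fin n → S.carrier), f (S.op n σ x) = T.op n σ (fun i => f (x i))

/-- Subuniverses (non-empty). -/
structure Sub (S : RhoAlg ρ) where
  univ : Set S.carrier
  nonempty : univ.Nonempty
  op_mem : ∀ n (σ : ρ n) (x : Fin n → S.carrier), (∀ i, x i ∈ univ) → S.op n σ x ∈ univ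

/-- The subalgebra on a subuniverse. -/
def Sub.toAlg {S : RhoAlg ρ} (T : S.Sub) : RhoAlg ρ where
  carrier := T.univ
  nonempty := T.nonempty.to_subtype
  op n σ x := ⟨S.op n σ (fun i => (x i).1), T.op_mem n σ _ (fun i => (x i).2)⟩

/-- Direct products. -/
def prod {J : Type u} (S : J → RhoAlg ρ) : RhoAlg ρ where
  carrier := ∀ j, (S j).carrier
  nonempty := ⟨fun j => (S j).nonempty.some⟩
  op n σ x := fun j => (S j).op n σ (fun i => x i j)

/-- Varieties: classes closed under homomorphic images, subalgebras and products (of arbitrary,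
possibly empty, families). -/
def IsVariety (H : Set (RhoAlg ρ)) : Prop :=
  (∀ S ∈ H, ∀ (T : RhoAlg ρ) (f : S.carrier → T.carrier),
    IsHom S T f → Function.Surjective f → T ∈ H) ∧
  (∀ S ∈ H, ∀ T : S.Sub, T.toAlg ∈ H) ∧
  (∀ (J : Type u) (S : J → RhoAlg ρ), (∀ j, S j ∈ H) → prod S ∈ H)

end RhoAlg

/-- `ρ`-terms over the variables `v₁, v₂, …`. -/
inductive RhoTerm (ρ : ℕ → Type u) : Type u
  | var : ℕ → RhoTerm ρ
  | app : (n : ℕ) → ρ n → (Fin n → RhoTerm ρ) → RhoTerm ρ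

namespace RhoAlg

variable {ρ : ℕ → Type u}

/-- The value of a `ρ`-term under an assignment of the variables. -/
def eval (S : RhoAlg ρ) (v : ℕ → S.carrier) : RhoTerm ρ → S.carrier
  | .var i => v i
  | .app n σ t => S.op n σ (fun i => S.eval v (t i))

/-- Satisfaction of a `ρ`-identity. -/
def Sat (S : RhoAlg ρ) (e : RhoTerm ρ × RhoTerm ρ) : Prop :=
  ∀ v : ℕ → S.carrier, S.eval v e.1 = S.eval v e.2

/-- The identities true in every member of a class. -/
def Th (H : Set (RhoAlg ρ)) : Set (RhoTerm ρ × RhoTerm ρ) := {e | ∀ S ∈ H, S.Sat e}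

/-- The models of a set of identities. -/
def Mod (E : Set (RhoTerm ρ × RhoTerm ρ)) : Set (RhoAlg ρ) := {S | ∀ e ∈ E, S.Sat e}

end RhoAlg

/-! ### Clone algebras -/

/-- Clone `τ`-algebras. -/
structure CloneAlg (τ : Type u) : Type (u + 1) where
  carrier : Type u
  q : (n : ℕ) → carrier → (Fin n → carrier) → carrier
  e : ℕ → carrier
  cst : τ → carrier
  q_e_lt : ∀ (n : ℕ) (i : Fin n) (x : Fin n → carrier), q n (e i) x = x i
  q_e_ge : ∀ (n j : ℕ) (x : Fin n → carrier), n ≤ j → q n (e j) x = e j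
  q_id : ∀ (n : ℕ) (x : carrier), q n x (fun i => e i) = x
  q_extend : ∀ (n k : ℕ) (x : carrier) (y : Fin n → carrier), n < k →
    q n x y = q k x (fun i => splice e y i)
  q_assoc : ∀ (n : ℕ) (x : carrier) (y z : Fin n → carrier),
    q n (q n x y) z = q n x (fun i => q n (y i) z)

namespace CloneAlg

variable {τ : Type u}

/-- Homomorphisms of clone `τ`-algebras. -/
structure IsHom (C D : CloneAlg τ) (f : C.carrier → D.carrier) : Prop where
  map_q : ∀ n x y, f (C.q n x y) = D.q n (f x) (fun i => f (y i))
  map_e : ∀ i, f (C.e i) = D.e i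
  map_cst : ∀ σ, f (C.cst σ) = D.cst σ

/-- Isomorphism of clone `τ`-algebras. -/
def Iso (C D : CloneAlg τ) : Prop := ∃ f, IsHom C D f ∧ Function.Bijective f

/-- Subuniverses. -/
structure Sub (C : CloneAlg τ) where
  univ : Set C.carrier
  q_mem : ∀ n x (y : Fin n → C.carrier), x ∈ univ → (∀ i, y i ∈ univ) → C.q n x y ∈ univ
  e_mem : ∀ i, C.e i ∈ univ
  cst_mem : ∀ σ, C.cst σ ∈ univ

/-- The subalgebra on a subuniverse. -/
def Sub.toAlg {C : CloneAlg τ} (F : C.Sub) : CloneAlg τ where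
  carrier := F.univ
  q n x y := ⟨C.q n x.1 (fun i => (y i).1), F.q_mem n _ _ x.2 (fun i => (y i).2)⟩
  e i := ⟨C.e i, F.e_mem i⟩
  cst σ := ⟨C.cst σ, F.cst_mem σ⟩
  q_e_lt n i x := Subtype.ext (C.q_e_lt n i _)
  q_e_ge n j x h := Subtype.ext (C.q_e_ge n j _ h)
  q_id n x := Subtype.ext (C.q_id n _)
  q_extend n k x y h := by
    refine Subtype.ext ((C.q_extend n k _ _ h).trans ?_)
    congr 1
    funext i
    simp only [splice]
    split_ifs <;> rfl
  q_assoc n x y z := Subtype.ext (C.q_assoc n _ _ _)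

/-- The subalgebra generated by a set. -/
def closure (C : CloneAlg τ) (G : Set C.carrier) : C.Sub where
  univ := {x | ∀ F : C.Sub, G ⊆ F.univ → x ∈ F.univ}
  q_mem n x y hx hy F hF := F.q_mem n x y (hx F hF) (fun i => hy i F hF)
  e_mem i F _ := F.e_mem i
  cst_mem σ F _ := F.cst_mem σ

/-- Direct products. -/
def prod {J : Type u} (C : J → CloneAlg τ) : CloneAlg τ where
  carrier := ∀ j, (C j).carrier
  q n x y := fun j => (C j).q n (x j) (fun i => y i j)
  e i := fun j => (C j).e i
  cst σ := fun j => (C j).cst σ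
  q_e_lt n i x := funext fun j => (C j).q_e_lt n i _
  q_e_ge n k x h := funext fun j => (C j).q_e_ge n k _ h
  q_id n x := funext fun j => (C j).q_id n _
  q_extend n k x y h := by
    funext j
    refine ((C j).q_extend n k _ _ h).trans ?_
    congr 1
    funext i
    simp only [splice]
    split_ifs <;> rfl
  q_assoc n x y z := funext fun j => (C j).q_assoc n _ _ _

/-- Varieties of clone `τ`-algebras: classes of clone `τ`-algebras closed under homomorphic images,
subalgebras and products. -/
def IsVariety (V : Set (CloneAlg τ)) : Prop :=
  (∀ C ∈ V, ∀ (D : CloneAlg τ) (f : C.carrier → D.carrier),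
    IsHom C D f → Function.Surjective f → D ∈ V) ∧
  (∀ C ∈ V, ∀ F : C.Sub, F.toAlg ∈ V) ∧
  (∀ (J : Type u) (C : J → CloneAlg τ), (∀ j, C j ∈ V) → prod C ∈ V)

/-- `a` is independent of `e_{k+1}`, which is `C.e k`:
`q_{k+1}(a, e_1, …, e_k, e_{k+2}) = a`. -/
def Indep (C : CloneAlg τ) (a : C.carrier) (k : ℕ) : Prop :=
  C.q (k + 1) a (fun i => if i.1 < k then C.e i else C.e (k + 1)) = a

/-- The dimension: the largest number `m` (counted from one) such that `a` depends on `e_m`, zero if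
there is no such `m`, and infinite if there are infinitely many. -/
noncomputable def dim (C : CloneAlg τ) (a : C.carrier) : ℕ∞ :=
  ⨆ k ∈ {k : ℕ | ¬ C.Indep a k}, ((k + 1 : ℕ) : ℕ∞)

end CloneAlg

/-! ### t-Algebras -/

/-- t-algebras of type `τ`. -/
structure TAlg (τ : Type u) : Type (u + 1) where
  carrier : Type u
  trace : Set (ℕ → carrier)
  isTrace : IsTrace trace
  op : τ → trace → carrier

namespace TAlg

variable {τ : Type u}

/-- `f` is a t-homomorphism. -/
def IsHom (A B : TAlg τ) (f : A.carrier → B.carrier) : Prop :=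
  ∃ h : ∀ s ∈ A.trace, f ∘ s ∈ B.trace,
    ∀ (σ : τ) (s : A.trace), f (A.op σ s) = B.op σ ⟨f ∘ s.1, h s.1 s.2⟩

/-- `f` is an onto t-homomorphism: it is onto on elements and on the threads of the traces. -/
def IsOntoHom (A B : TAlg τ) (f : A.carrier → B.carrier) : Prop :=
  IsHom A B f ∧ Function.Surjective f ∧ ∀ r ∈ B.trace, ∃ s ∈ A.trace, f ∘ s = r

/-- Pairs `(B, b)` that determine a t-subalgebra. -/
structure Sub (A : TAlg τ) where
  univ : Set A.carrier
  trace : Set (ℕ → univ)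
  isTrace : IsTrace trace
  trace_sub : ∀ s ∈ trace, (fun i => (s i).1) ∈ A.trace
  op_mem : ∀ (σ : τ) (s : ℕ → univ) (hs : s ∈ trace), A.op σ ⟨_, trace_sub s hs⟩ ∈ univ

/-- The t-subalgebra determined by a pair. -/
def Sub.toAlg {A : TAlg τ} (B : A.Sub) : TAlg τ where
  carrier := B.univ
  trace := B.trace
  isTrace := B.isTrace
  op σ s := ⟨A.op σ ⟨_, B.trace_sub s.1 s.2⟩, B.op_mem σ s.1 s.2⟩

/-- The full t-subalgebra with trace `b`. -/
def restrict (A : TAlg τ) (b : Set (ℕ → A.carrier)) (hb : IsTrace b) (h : b ⊆ A.trace) :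
    TAlg τ where
  carrier := A.carrier
  trace := b
  isTrace := hb
  op σ s := A.op σ ⟨s.1, h s.2⟩

/-- t-products. -/
def prod {J : Type u} (A : J → TAlg τ) : TAlg τ where
  carrier := ∀ j, (A j).carrier
  trace := {s | ∀ j, (fun k => s k j) ∈ (A j).trace}
  isTrace _ hs _ hr j := (A j).isTrace _ (hs j) _ (hr.subset fun _ hi h => hi (congrFun h j))
  op σ s := fun j => (A j).op σ ⟨fun k => s.1 k j, s.2 j⟩

/-- Full functional clone `τ`-algebra with value domain `A`: all t-operations on the trace. -/
def fullFCA (A : TAlg τ) : CloneAlg τ where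
  carrier := A.trace → A.carrier
  q n φ ψ := fun s => φ ⟨splice s.1 (fun i => ψ i s), A.isTrace.splice_mem s.2 _⟩
  e i := fun s => s.1 i
  cst σ := A.op σ
  q_e_lt n i x := by funext s; simp [splice]
  q_e_ge n j x h := by funext s; simp [splice, Nat.not_lt.mpr h]
  q_id n x := by
    funext s
    congr 1
    apply Subtype.ext
    funext i
    simp [splice]
  q_extend n k x y h := by
    funext s
    congr 1
    apply Subtype.ext
    funext i
    simp only [splice]
    by_cases h1 : i < n
    · simp [h1, h1.trans h]
    · simp [h1]
  q_assoc n x y z := by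
    funext s
    simp only
    congr 1
    apply Subtype.ext
    funext i
    simp only [splice]
    by_cases h1 : i < n <;> simp [h1]

/-- The constant t-operations. -/
def constOp (A : TAlg τ) (b : A.carrier) : A.fullFCA.carrier := fun _ => b

/-- The polynomial clone algebra over `A`: the subalgebra of the full functional clone algebra
generated by the constant t-operations. -/
def polyClone (A : TAlg τ) : A.fullFCA.Sub := A.fullFCA.closure (Set.range A.constOp)

/-- Rich functional clone algebras: those that contain the polynomial clone algebra. -/
def IsRich {A : TAlg τ} (F : A.fullFCA.Sub) : Prop := A.polyClone.univ ⊆ F.univ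

end TAlg

/-! ### Hyperterms -/

/-- Infinitely branching trees with leaves `e₁, e₂, …` and nodes labelled by `τ ∪ X`. -/
inductive HTree (τ X : Type u) : Type u
  | e : ℕ → HTree τ X
  | app : τ ⊕ X → (ℕ → HTree τ X) → HTree τ X

namespace HTree

variable {τ X : Type u}

/-- The `τ`-hyperterms over `X`: built up from `e₁, e₂, …` by passing from `t₁, …, tₙ` to
`w(t₁, …, tₙ, e_{n+1}, e_{n+2}, …)`, with `w` in `τ ∪ X`. -/
inductive IsHyperterm : HTree τ X → Prop
  | e (i : ℕ) : IsHyperterm (HTree.e i)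
  | app (w : τ ⊕ X) (n : ℕ) (t : Fin n → HTree τ X) (h : ∀ i, IsHyperterm (t i)) :
      IsHyperterm (HTree.app w (splice HTree.e t))

/-- Simultaneous substitution for `e₁, …, eₙ`. -/
def subst {n : ℕ} (u : Fin n → HTree τ X) : HTree τ X → HTree τ X
  | .e i => splice HTree.e u i
  | .app w a => .app w (fun i => (a i).subst u)

theorem isHyperterm_splice {n : ℕ} {u : Fin n → HTree τ X} (hu : ∀ i, (u i).IsHyperterm) (i : ℕ) :
    (splice HTree.e u i).IsHyperterm := by
  simp only [splice]
  split_ifs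
  · exact hu _
  · exact .e i

theorem isHyperterm_subst {n : ℕ} {u : Fin n → HTree τ X} (hu : ∀ i, (u i).IsHyperterm)
    {t : HTree τ X} (ht : t.IsHyperterm) : (t.subst u).IsHyperterm := by
  induction ht with
  | e i => exact isHyperterm_splice hu i
  | app w k t _ ih =>
    have key : (HTree.app w (splice HTree.e t)).subst u =
        HTree.app w (splice HTree.e
          (fun i : Fin (max n k) => (splice HTree.e t i).subst u)) := by
      simp only [subst]
      congr 1
      funext i
      by_cases h : i < max n k
      · simp [splice, h]
      · have h1 : ¬ i < n := fun h' => h (lt_max_of_lt_left h')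
        have h2 : ¬ i < k := fun h' => h (lt_max_of_lt_right h')
        simp [splice, h1, h2, subst]
    rw [key]
    refine .app _ _ _ fun i => ?_
    by_cases h : i.1 < k
    · simpa [splice, h] using ih ⟨i, h⟩
    · simpa [splice, h, subst] using isHyperterm_splice hu i

end HTree

/-- The clone `τ`-algebra of `τ`-hyperterms over `X`. -/
def hyperterms (τ X : Type u) : CloneAlg τ where
  carrier := {t : HTree τ X // t.IsHyperterm}
  q n t u := ⟨t.1.subst (fun i => (u i).1), HTree.isHyperterm_subst (fun i => (u i).2) t.2⟩
  e i := ⟨.e i, .e i⟩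
  cst σ := ⟨.app (.inl σ) (splice HTree.e Fin.elim0), .app _ 0 _ (fun i => i.elim0)⟩
  q_e_lt n i x := Subtype.ext (by simp [HTree.subst, splice])
  q_e_ge n j x h := Subtype.ext (by simp [HTree.subst, splice, Nat.not_lt.mpr h])
  q_id n x := Subtype.ext (by
    show x.1.subst (fun i : Fin n => HTree.e i) = x.1
    induction x.1 with
    | e i => simp [HTree.subst, splice]
    | app w a ih => simp only [HTree.subst, ih])
  q_extend n k x y h := Subtype.ext (by
    show x.1.subst _ = x.1.subst _
    induction x.1 with
    | e i =>
      simp only [HTree.subst, splice]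
      by_cases h1 : i < n
      · simp [h1, h1.trans h]
      · simp [h1]
    | app w a ih => simp only [HTree.subst, ih])
  q_assoc n x y z := Subtype.ext (by
    show (x.1.subst _).subst _ = x.1.subst _
    induction x.1 with
    | e i =>
      simp only [HTree.subst, splice]
      by_cases h1 : i < n
      · simp [h1]
      · simp [h1, HTree.subst, splice]
    | app w a ih => simp only [HTree.subst, ih])

/-- The element `x` of `X` as a hyperterm: `x(e₁, e₂, …)`. -/
def hypervar (τ : Type u) {X : Type u} (x : X) : (hyperterms τ X).carrier :=
  ⟨.app (.inr x) (splice HTree.e Fin.elim0), .app _ 0 _ (fun i => i.elim0)⟩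

/-- The clone `τ`-algebra of `τ`-terms, i.e. of `τ`-hyperterms over the empty set. -/
abbrev tTerms (τ : Type u) : CloneAlg τ := hyperterms τ PEmpty.{u + 1}

namespace TAlg

variable {τ : Type u}

open Classical in
/-- Value of a term at a thread `s` of the trace: `e_i` has the value `s_i`, and
`σ(t₁, …, tₙ, e_{n+1}, …)` has the value `σ` of the thread of values of the arguments. The last
branch never occurs for terms, see `eval_splice`. -/
noncomputable def evalTree (A : TAlg τ) (s : A.trace) : HTree τ PEmpty.{u + 1} → A.carrier
  | .e i => s.1 i
  | .app (.inl σ) a =>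
      if h : (fun i => A.evalTree s (a i)) ∈ A.trace then A.op σ ⟨_, h⟩ else s.1 0

theorem eval_splice (A : TAlg τ) (s : A.trace) {n : ℕ} (t : Fin n → HTree τ PEmpty.{u + 1}) :
    (fun i => A.evalTree s (splice HTree.e t i)) = splice s.1 (fun i => A.evalTree s (t i)) := by
  funext i
  simp only [splice]
  split_ifs <;> simp [evalTree]

theorem eval_app (A : TAlg τ) (s : A.trace) (σ : τ) {n : ℕ}
    (t : Fin n → HTree τ PEmpty.{u + 1}) :
    A.evalTree s (.app (.inl σ) (splice HTree.e t)) =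
      A.op σ ⟨splice s.1 (fun i => A.evalTree s (t i)), A.isTrace.splice_mem s.2 _⟩ := by
  have h : (fun i => A.evalTree s (splice HTree.e t i)) ∈ A.trace := by
    rw [eval_splice]; exact A.isTrace.splice_mem s.2 _
  rw [evalTree, dif_pos h]
  congr 1
  exact Subtype.ext (eval_splice A s t)

/-- The term operation of a term. -/
noncomputable def termOp (A : TAlg τ) (t : (tTerms τ).carrier) : A.fullFCA.carrier :=
  fun s => A.evalTree s t.1

/-- `t ↦ termOp t` is a homomorphism of clone algebras from the terms into the full functional clone
algebra over `A`. -/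
theorem termOp_isHom (A : TAlg τ) : CloneAlg.IsHom (tTerms τ) A.fullFCA A.termOp where
  map_q n x y := by
    funext s
    show A.evalTree s (x.1.subst _) = A.evalTree ⟨splice s.1 _, _⟩ x.1
    obtain ⟨x, hx⟩ := x
    simp only
    induction hx with
    | e i => exact congrFun (eval_splice A s _) i
    | app w k t _ ih =>
      rcases w with σ | w
      · rw [eval_app]
        have h : (fun i => A.evalTree s ((splice HTree.e t i).subst (fun i => (y i).1))) =
            splice (splice s.1 (fun i => A.termOp (y i) s))
              (fun i => A.evalTree ⟨splice s.1 (fun i => A.termOp (y i) s),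
                A.isTrace.splice_mem s.2 _⟩ (t i)) := by
          funext i
          by_cases h1 : i < k
          · simpa [splice, h1] using ih ⟨i, h1⟩
          · have := congrFun (eval_splice A s (fun i => (y i).1)) i
            simpa [splice, h1, HTree.subst, termOp] using this
        have h' : (fun i => A.evalTree s ((splice HTree.e t i).subst (fun i => (y i).1))) ∈
            A.trace := by
          rw [h]
          exact A.isTrace.splice_mem (A.isTrace.splice_mem s.2 _) _
        rw [HTree.subst, evalTree, dif_pos h']
        congr 1
        exact Subtype.ext h
      · exact w.elim
  map_e i := rfl
  map_cst σ := by
    funext s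
    show A.evalTree s _ = A.op σ s
    rw [show ((tTerms τ).cst σ).1 = HTree.app (.inl σ) (splice HTree.e Fin.elim0) from rfl,
      eval_app]
    congr 1

/-- The equational t-theory of a t-algebra. -/
def theory (A : TAlg τ) : Set ((tTerms τ).carrier × (tTerms τ).carrier) :=
  {e | A.termOp e.1 = A.termOp e.2}

/-- The equational t-theory of a class of t-algebras. -/
def classTheory (K : Set (TAlg τ)) : Set ((tTerms τ).carrier × (tTerms τ).carrier) :=
  {e | ∀ A ∈ K, e ∈ A.theory}

/-- The t-algebras that satisfy a set of identities. -/
def Mod (E : Set ((tTerms τ).carrier × (tTerms τ).carrier)) : Set (TAlg τ) :=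
  {A | E ⊆ A.theory}

/-- Weak homomorphisms from the hyperterms: every element of `X` goes to a constant
t-operation. -/
def IsWeakHom (A : TAlg τ) (X : Type u) (α : (hyperterms τ X).carrier → A.fullFCA.carrier) : Prop :=
  CloneAlg.IsHom (hyperterms τ X) A.fullFCA α ∧ ∀ x : X, ∃ b, α (hypervar τ x) = A.constOp b

/-- The equational w-hypertheory of a t-algebra: the hyperidentities that it weakly satisfies. -/
def wTheory (A : TAlg τ) (X : Type u) :
    Set ((hyperterms τ X).carrier × (hyperterms τ X).carrier) :=
  {e | ∀ α, A.IsWeakHom X α → α e.1 = α e.2}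

/-- The equational w-hypertheory of a class of t-algebras. -/
def classWTheory (K : Set (TAlg τ)) (X : Type u) :
    Set ((hyperterms τ X).carrier × (hyperterms τ X).carrier) :=
  {e | ∀ A ∈ K, e ∈ A.wTheory X}

/-- The t-algebras that weakly satisfy a set of hyperidentities. -/
def ModW {X : Type u} (E : Set ((hyperterms τ X).carrier × (hyperterms τ X).carrier)) :
    Set (TAlg τ) :=
  {A | E ⊆ A.wTheory X}

/-- The t-subalgebra generated by a thread `s` of the trace: its universe consists of the values
at `s` of all terms, its trace of the threads in this universe that are equivalent to `s`. -/
def gen (A : TAlg τ) (s : A.trace) : A.Sub where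
  univ := {a | ∃ t, A.termOp t s = a}
  trace := {r | ThreadEquiv (fun i => (r i).1) s.1}
  isTrace r hr r' h := by
    refine ThreadEquiv.trans (h.subset ?_) hr
    intro i hi h'
    exact hi (congrArg Subtype.val h')
  trace_sub r hr := A.isTrace s.1 s.2 _ hr
  op_mem σ r hr := by
    obtain ⟨n, hn⟩ := (show Set.Finite _ from hr).bddAbove
    choose t ht using fun i => (r i).2
    refine ⟨⟨.app (.inl σ) (splice HTree.e (fun i : Fin (n + 1) => (t i).1)),
      .app _ _ _ (fun i => (t i).2)⟩, ?_⟩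
    show A.evalTree s _ = _
    rw [eval_app]
    congr 1
    apply Subtype.ext
    funext i
    by_cases h : i < n + 1
    · simpa [splice, h, termOp] using ht i
    · simp only [splice, h, dite_false]
      by_contra h'
      exact h (Nat.lt_succ_of_le (hn (fun h'' => h' h''.symm)))

/-! ### Varieties of t-algebras -/

/-- t-varieties: classes closed under t-homomorphic images, t-subalgebras and t-products. -/
def IsTVariety (K : Set (TAlg τ)) : Prop :=
  (∀ A ∈ K, ∀ (B : TAlg τ) (f : A.carrier → B.carrier), IsOntoHom A B f → B ∈ K) ∧
  (∀ A ∈ K, ∀ B : A.Sub, B.toAlg ∈ K) ∧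
  (∀ (J : Type u) (A : J → TAlg τ), (∀ j, A j ∈ K) → prod A ∈ K)

/-- Ft-varieties: t-varieties closed under full t-expansion. -/
def IsFtVariety (K : Set (TAlg τ)) : Prop :=
  IsTVariety K ∧
    ∀ A : TAlg τ, (∀ d (hd : d ∈ basicParts A.trace), A.restrict d hd.1.isTrace hd.2 ∈ K) → A ∈ K

/-- Et-varieties: t-varieties closed under t-expansion. -/
def IsEtVariety (K : Set (TAlg τ)) : Prop :=
  IsTVariety K ∧ ∀ A : TAlg τ, (∀ s : A.trace, (A.gen s).toAlg ∈ K) → A ∈ K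

/-- All clone algebras isomorphic to a functional clone algebra with value domain in `K`. -/
def up (K : Set (TAlg τ)) : Set (CloneAlg τ) :=
  {C | ∃ A ∈ K, ∃ F : A.fullFCA.Sub, CloneAlg.Iso F.toAlg C}

/-- All t-algebras that are the value domain of some rich functional clone algebra in `V`. -/
def downRich (V : Set (CloneAlg τ)) : Set (TAlg τ) :=
  {A | ∃ F : A.fullFCA.Sub, IsRich F ∧ F.toAlg ∈ V}

/-- All t-algebras that are the value domain of some functional clone algebra in `V`. -/
def down (V : Set (CloneAlg τ)) : Set (TAlg τ) :=
  {A | ∃ F : A.fullFCA.Sub, F.toAlg ∈ V}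

end TAlg

/-! ### t-Algebras from algebras -/

/-- The set of all operation symbols of the finitary type `ρ`. -/
abbrev starType (ρ : ℕ → Type u) : Type u := Σ n, ρ n

/-- `ρ`-dimensional t-algebras. -/
def IsRhoDimensional {ρ : ℕ → Type u} (A : TAlg (starType ρ)) : Prop :=
  ∀ (n : ℕ) (σ : ρ n), A.fullFCA.dim (A.op ⟨n, σ⟩) ≤ n

/-- The t-algebra extension of `H`: all `ρ`-dimensional t-algebras `A` such that, for every basic part
`d` of the trace of `A`, the full t-subalgebra of `A` with trace `d` is the t-algebra of trace `d` over
some member of `H` on the same carrier. -/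
def starClass {ρ : ℕ → Type u} (H : Set (RhoAlg ρ)) : Set (TAlg (starType ρ)) :=
  {A | IsRhoDimensional A ∧
    ∀ d (hd : d ∈ basicParts A.trace), ∃ (hA : Nonempty A.carrier) (S : RhoStr ρ A.carrier),
      RhoAlg.mk A.carrier hA S ∈ H ∧
      ∀ (n : ℕ) (σ : ρ n) (s : d),
        (A.restrict d hd.1.isTrace hd.2).op ⟨n, σ⟩ s = topExt (S n σ) d s}

/-! All nine conditions lie between the strongest one, that `starClass H` is defined by identities
between terms, and the weakest one, that it is a t-variety.

If `H` is a variety, it is equational by the classical Birkhoff argument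
(`RhoAlg.IsVariety.eq_Mod_Th`). Its identities translate into identities between terms. The
condition on dimensions also consists of identities, each saying that a symbol is independent of one
projection. A t-algebra satisfying both kinds carries, on each basic part of its trace, the
structure of a model of `Th H`, so `starClass H` is equational (`TAlg.starClass_eq_Mod`).

An equational class of t-algebras has every listed closure property. Term values are computed inside
the t-subalgebra generated by a thread and inside the basic class of that thread. Identities between
terms are special hyperidentities. On the side of clone algebras they are equations between
variable-free expressions, which pass along every homomorphism. Every clone algebra embeds into the
functional clone algebra over its own carrier, on the class of the thread of projections
(`CloneAlg.isHom_threadOp`); hence `up` turns equational classes into equational classes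
(`TAlg.up_Mod`).

Each remaining condition gives a t-variety. The two substantial cases are `TAlg.isTVariety_ModW` and
`TAlg.isTVariety_of_downRich`. The circle closes because a `ρ`-algebra can be viewed as a t-algebra
on all threads. This reflects membership in `H` and is compatible with quotients, subalgebras and
products (`TAlg.isVariety_of_isTVariety_starClass`). -/

/-! ### Homomorphisms of clone algebras and the representation by t-operations. -/

namespace CloneAlg

variable {τ : Type u}

theorem IsHom.id (C : CloneAlg τ) : IsHom C C _root_.id :=
  ⟨fun _ _ _ => rfl, fun _ => rfl, fun _ => rfl⟩

theorem IsHom.comp {C D E : CloneAlg τ} {g : D.carrier → E.carrier} {f : C.carrier → D.carrier}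
    (hg : IsHom D E g) (hf : IsHom C D f) : IsHom C E (g ∘ f) where
  map_q n x y := by simp [hf.map_q, hg.map_q]
  map_e i := by simp [hf.map_e, hg.map_e]
  map_cst σ := by simp [hf.map_cst, hg.map_cst]

theorem Sub.isHom_val {C : CloneAlg τ} (F : C.Sub) :
    IsHom F.toAlg C (Subtype.val : F.univ → C.carrier) :=
  ⟨fun _ _ _ => rfl, fun _ => rfl, fun _ => rfl⟩

theorem isHom_proj {J : Type u} (C : J → CloneAlg τ) (j : J) :
    IsHom (prod C) (C j) (fun x => x j) :=
  ⟨fun _ _ _ => rfl, fun _ => rfl, fun _ => rfl⟩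

/-- The image of a homomorphism. -/
def IsHom.range {C D : CloneAlg τ} {f : C.carrier → D.carrier} (hf : IsHom C D f) : D.Sub where
  univ := Set.range f
  q_mem n x y hx hy := by
    obtain ⟨a, rfl⟩ := hx
    choose b hb using hy
    refine ⟨C.q n a b, ?_⟩
    rw [hf.map_q]
    congr 1
    exact funext hb
  e_mem i := ⟨C.e i, hf.map_e i⟩
  cst_mem σ := ⟨C.cst σ, hf.map_cst σ⟩

theorem IsHom.isHom_rangeFactorization {C D : CloneAlg τ} {f : C.carrier → D.carrier}
    (hf : IsHom C D f) : IsHom C hf.range.toAlg (Set.rangeFactorization f) :=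
  ⟨fun _ _ _ => Subtype.ext (hf.map_q _ _ _), fun _ => Subtype.ext (hf.map_e _),
    fun _ => Subtype.ext (hf.map_cst _)⟩

theorem Iso.symm {C D : CloneAlg τ} (h : Iso C D) : Iso D C := by
  obtain ⟨f, hf, hb⟩ := h
  obtain ⟨g, hl, hr⟩ := Function.bijective_iff_has_inverse.mp hb
  refine ⟨g, ⟨fun n x y => ?_, fun i => ?_, fun σ => ?_⟩,
    Function.bijective_iff_has_inverse.mpr ⟨f, hr, hl⟩⟩
  · apply hb.1
    rw [hr, hf.map_q, hr]
    congr 1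
    exact funext fun i => (hr _).symm
  · apply hb.1
    rw [hr, hf.map_e]
  · apply hb.1
    rw [hr, hf.map_cst]

/-- The full subalgebra. -/
def topSub (C : CloneAlg τ) : C.Sub := (IsHom.id C).range

/-- An algebra that is the image of a subalgebra of a member of a variety, given as a compatible
relation that is functional and onto, belongs to the variety. -/
theorem IsVariety.of_rel {V : Set (CloneAlg τ)} (hV : IsVariety V) {C D : CloneAlg τ} (hC : C ∈ V)
    (R : C.carrier → D.carrier → Prop)
    (hq : ∀ n x x' (y : Fin n → C.carrier) (y' : Fin n → D.carrier), R x x' →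
      (∀ i, R (y i) (y' i)) → R (C.q n x y) (D.q n x' y'))
    (he : ∀ i, R (C.e i) (D.e i)) (hcst : ∀ σ, R (C.cst σ) (D.cst σ))
    (hfun : ∀ x y z, R x y → R x z → y = z) (honto : ∀ y, ∃ x, R x y) : D ∈ V := by
  -- The domain of `R` is a subalgebra; on it `R` is the graph of a homomorphism onto `D`.
  let F : C.Sub :=
    { univ := {x | ∃ y, R x y}
      q_mem := by
        rintro n x y ⟨x', hx⟩ hy
        choose y' hy using hy
        exact ⟨_, hq n x x' y y' hx hy⟩
      e_mem := fun i => ⟨_, he i⟩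
      cst_mem := fun σ => ⟨_, hcst σ⟩ }
  have hF := hV.2.1 C hC F
  choose g hg using fun x : F.univ => x.2
  refine hV.1 _ hF D g ⟨fun n x y => ?_, fun i => ?_, fun σ => ?_⟩ fun y => ?_
  · exact hfun _ _ _ (hg _) (hq _ _ _ _ _ (hg x) fun i => hg (y i))
  · exact hfun _ _ _ (hg _) (he i)
  · exact hfun _ _ _ (hg _) (hcst σ)
  · obtain ⟨x, hx⟩ := honto y
    exact ⟨⟨x, y, hx⟩, hfun _ _ _ (hg _) hx⟩

theorem q_extend_of_le (C : CloneAlg τ) {n k : ℕ} (h : n ≤ k) (x : C.carrier)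
    (y : Fin n → C.carrier) : C.q n x y = C.q k x (fun i => splice C.e y i) := by
  rcases h.lt_or_eq with h | rfl
  · exact C.q_extend n k x y h
  · simp [splice]

/-- Padding with projections is harmless by the extension axiom, so `threadOp` will not depend on
the chosen bound. -/
theorem q_thread (C : CloneAlg τ) {n k : ℕ} (h : n ≤ k) (x : C.carrier) (r : ℕ → C.carrier)
    (hr : ∀ i, n ≤ i → r i = C.e i) :
    C.q n x (fun i => r i) = C.q k x (fun i => r i) := by
  rw [C.q_extend_of_le h]
  congr 1
  funext i
  by_cases hi : i.1 < n
  · simp [splice, hi]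
  · simp [splice, hi, hr i (not_lt.mp hi)]

theorem exists_bound (C : CloneAlg τ) (r : {r : ℕ → C.carrier // ThreadEquiv r C.e}) :
    ∃ n, ∀ i, n ≤ i → r.1 i = C.e i := by
  obtain ⟨n, hn⟩ := (show Set.Finite _ from r.2).bddAbove
  refine ⟨n + 1, fun i hi => ?_⟩
  by_contra h
  exact absurd (hn h) (by omega)

/-- The t-operation of an element, on the threads that are equivalent to `e₁, e₂, …`: the common
value of `q_n(x, r₁, …, r_n)` for large `n`. -/
noncomputable def threadOp (C : CloneAlg τ) (x : C.carrier)
    (r : {r : ℕ → C.carrier // ThreadEquiv r C.e}) : C.carrier :=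
  C.q (C.exists_bound r).choose x (fun i => r.1 i)

theorem threadOp_eq (C : CloneAlg τ) (x : C.carrier)
    (r : {r : ℕ → C.carrier // ThreadEquiv r C.e}) {n : ℕ} (hn : ∀ i, n ≤ i → r.1 i = C.e i) :
    C.threadOp x r = C.q n x (fun i => r.1 i) := by
  have h := (C.exists_bound r).choose_spec
  rw [threadOp, C.q_thread (le_max_left _ n) x r.1 h, ← C.q_thread (le_max_right _ n) x r.1 hn]

/-- The t-algebra over the carrier of a clone algebra whose trace is the class of `e₁, e₂, …`. -/
noncomputable def repr (C : CloneAlg τ) : TAlg τ where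
  carrier := C.carrier
  trace := {r | ThreadEquiv r C.e}
  isTrace _ hr _ h := ThreadEquiv.trans h hr
  op σ r := C.threadOp (C.cst σ) r

/-- The thread `e₁, e₂, …`. -/
def reprThread (C : CloneAlg τ) : C.repr.trace := ⟨C.e, ThreadEquiv.refl _⟩

/-- Since the thread of projections needs no substitution, the bound 0 is admissible. Evaluation at
this thread inverts the representation, which makes it injective. -/
theorem threadOp_reprThread (C : CloneAlg τ) (x : C.carrier) :
    C.threadOp x C.reprThread = x :=
  (C.threadOp_eq x C.reprThread (n := 0) (fun _ _ => rfl)).trans (C.q_id 0 x)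

/-- The representation theorem for clone algebras. -/
theorem isHom_threadOp (C : CloneAlg τ) : IsHom C C.repr.fullFCA C.threadOp where
  map_q n x y := by
    funext r
    obtain ⟨m, hm⟩ := C.exists_bound r
    -- Associativity needs a single arity; `max n m` accommodates both the arguments `y` and the
    -- nontrivial entries of `r`.
    have hr : ∀ i, max n m ≤ i → r.1 i = C.e i := fun i hi => hm i (le_trans (le_max_right _ _) hi)
    rw [C.threadOp_eq _ r hr, C.q_extend_of_le (le_max_left n m) x y, C.q_assoc]
    refine Eq.trans ?_ (C.threadOp_eq x ⟨splice r.1 (fun i => C.threadOp (y i) r),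
      C.repr.isTrace.splice_mem r.2 _⟩ (n := max n m) ?_).symm
    · congr 1
      funext i
      by_cases hi : i.1 < n
      · simp only [splice, hi, dite_true]
        exact (C.threadOp_eq _ r hr).symm
      · simp only [splice, hi, dite_false]
        exact C.q_e_lt _ i _
    · intro i hi
      have : ¬ i < n := not_lt.mpr (le_trans (le_max_left _ _) hi)
      simp only [splice, this, dite_false]
      exact hr i hi
  map_e i := by
    funext r
    obtain ⟨m, hm⟩ := C.exists_bound r
    rw [C.threadOp_eq _ r (n := max m (i + 1)) fun k hk => hm k (le_trans (le_max_left _ _) hk)]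
    exact C.q_e_lt _ ⟨i, lt_of_lt_of_le (Nat.lt_succ_self i) (le_max_right _ _)⟩ _
  map_cst σ := rfl

end CloneAlg

/-! ### Generation of the hyperterms. -/

section Hyperterms

variable {τ X : Type u}

/-- Reduces the formation of trees to `q` and bare symbols, so that induction on hyperterms can be
phrased in clone algebra operations. -/
theorem hyperterms_q_symbol (w : τ ⊕ X) {n : ℕ} (t : Fin n → (hyperterms τ X).carrier)
    (hw : (HTree.app w (splice HTree.e Fin.elim0)).IsHyperterm)
    (ht : (HTree.app w (splice HTree.e fun i => (t i).1)).IsHyperterm) :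
    (hyperterms τ X).q n ⟨_, hw⟩ t = ⟨_, ht⟩ := by
  apply Subtype.ext
  show HTree.subst _ _ = _
  simp only [HTree.subst, HTree.app.injEq, true_and]
  funext i
  simp [splice, HTree.subst]

/-- Hyperterms are generated by the `e_i` and the symbols. -/
theorem hyperterms_induction {P : (hyperterms τ X).carrier → Prop}
    (e : ∀ i, P ((hyperterms τ X).e i)) (cst : ∀ σ, P ((hyperterms τ X).cst σ))
    (var : ∀ x : X, P (hypervar τ x))
    (q : ∀ n t u, P t → (∀ i, P (u i)) → P ((hyperterms τ X).q n t u))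
    (t : (hyperterms τ X).carrier) : P t := by
  obtain ⟨t, ht⟩ := t
  induction ht with
  | e i => exact e i
  | app w n t h ih =>
    have hw : (HTree.app w (splice HTree.e Fin.elim0)).IsHyperterm :=
      .app w 0 _ (fun i => i.elim0)
    rw [← hyperterms_q_symbol w (fun i => ⟨t i, h i⟩) hw]
    refine q _ _ _ ?_ ih
    rcases w with σ | x
    · exact cst σ
    · exact var x

theorem hyperterms_hom_ext {C : CloneAlg τ} {f g : (hyperterms τ X).carrier → C.carrier}
    (hf : CloneAlg.IsHom _ C f) (hg : CloneAlg.IsHom _ C g)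
    (h : ∀ x : X, f (hypervar τ x) = g (hypervar τ x)) : f = g := by
  funext t
  refine hyperterms_induction (P := fun t => f t = g t) (fun i => ?_) (fun σ => ?_) h (fun n t u ht hu => ?_) t
  · rw [hf.map_e, hg.map_e]
  · rw [hf.map_cst, hg.map_cst]
  · rw [hf.map_q, hg.map_q, ht]
    congr 1
    exact funext hu

end Hyperterms

/-! ### The initial homomorphism and equational classes of clone algebras. -/

namespace CloneAlg

variable {τ : Type u}

/-- The unique homomorphism from the terms into a clone algebra. -/
noncomputable def init (C : CloneAlg τ) (t : (tTerms τ).carrier) : C.carrier :=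
  C.repr.termOp t C.reprThread

/-- Term operations over `C.repr` lie in the image of the representation, because that image
contains projections and symbols and is closed under `q`. The preimage is then found by evaluating
at the thread of projections. -/
theorem threadOp_init (C : CloneAlg τ) (t : (tTerms τ).carrier) :
    C.threadOp (C.init t) = C.repr.termOp t := by
  have h : ∃ x, C.threadOp x = C.repr.termOp t := by
    refine hyperterms_induction (P := fun t => ∃ x, C.threadOp x = C.repr.termOp t)
      (fun i => ?_) (fun σ => ?_) (fun x => x.elim)
      (fun n t u ht hu => ?_) t
    · exact ⟨_, (C.isHom_threadOp.map_e i).trans (C.repr.termOp_isHom.map_e i).symm⟩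
    · exact ⟨_, (C.isHom_threadOp.map_cst σ).trans (C.repr.termOp_isHom.map_cst σ).symm⟩
    · obtain ⟨x, hx⟩ := ht
      choose y hy using hu
      refine ⟨C.q n x y, ?_⟩
      rw [C.isHom_threadOp.map_q, C.repr.termOp_isHom.map_q, hx]
      congr 1
      exact funext hy
  obtain ⟨x, hx⟩ := h
  rw [← hx, init, ← hx, C.threadOp_reprThread]

theorem threadOp_injective (C : CloneAlg τ) : Function.Injective C.threadOp := fun x y h => by
  rw [← C.threadOp_reprThread x, h, C.threadOp_reprThread]

theorem isHom_init (C : CloneAlg τ) : IsHom (tTerms τ) C C.init where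
  map_q n x y := by
    apply C.threadOp_injective
    rw [threadOp_init, C.repr.termOp_isHom.map_q, C.isHom_threadOp.map_q]
    simp only [threadOp_init]
    rfl
  map_e i := by
    apply C.threadOp_injective
    rw [threadOp_init, C.repr.termOp_isHom.map_e, C.isHom_threadOp.map_e]
  map_cst σ := by
    apply C.threadOp_injective
    rw [threadOp_init, C.repr.termOp_isHom.map_cst, C.isHom_threadOp.map_cst]

theorem eq_init {C : CloneAlg τ} {f : (tTerms τ).carrier → C.carrier}
    (hf : IsHom (tTerms τ) C f) : f = C.init :=
  hyperterms_hom_ext hf C.isHom_init fun x => x.elim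

theorem IsHom.map_init {C D : CloneAlg τ} {f : C.carrier → D.carrier} (hf : IsHom C D f)
    (t : (tTerms τ).carrier) : f (C.init t) = D.init t :=
  congrFun (eq_init (hf.comp C.isHom_init)) t

/-- The clone algebras that satisfy a set of identities between terms. -/
def models (E : Set ((tTerms τ).carrier × (tTerms τ).carrier)) : Set (CloneAlg τ) :=
  {C | ∀ e ∈ E, C.init e.1 = C.init e.2}

theorem models_of_injective {E : Set ((tTerms τ).carrier × (tTerms τ).carrier)} {C D : CloneAlg τ}
    (hD : D ∈ models E) {f : C.carrier → D.carrier} (hf : IsHom C D f)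
    (hi : Function.Injective f) : C ∈ models E := fun e he => by
  apply hi
  rw [hf.map_init, hf.map_init, hD e he]

/-- Surjectivity is not needed: the identities involve no variables ranging over the clone algebra.
-/
theorem models_of_hom {E : Set ((tTerms τ).carrier × (tTerms τ).carrier)} {C D : CloneAlg τ}
    (hC : C ∈ models E) {f : C.carrier → D.carrier} (hf : IsHom C D f) : D ∈ models E :=
  fun e he => by rw [← hf.map_init, ← hf.map_init, hC e he]

theorem isVariety_models (E : Set ((tTerms τ).carrier × (tTerms τ).carrier)) :
    IsVariety (models E) := by
  refine ⟨fun C hC D f hf _ => models_of_hom hC hf, fun C hC F =>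
    models_of_injective hC F.isHom_val Subtype.val_injective, fun J C hC e he => ?_⟩
  funext j
  exact ((isHom_proj C j).map_init _).trans
    ((hC j e he).trans ((isHom_proj C j).map_init _).symm)

end CloneAlg

/-! ### Passage between classes of t-algebras and classes of clone algebras. -/

namespace TAlg

open CloneAlg

variable {τ : Type u}

theorem termOp_eq_init (A : TAlg τ) : A.termOp = A.fullFCA.init := eq_init A.termOp_isHom

theorem mem_Mod_iff {E : Set ((tTerms τ).carrier × (tTerms τ).carrier)} {A : TAlg τ} :
    A ∈ Mod E ↔ A.fullFCA ∈ models E := by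
  have h : (∀ e ∈ E, A.fullFCA.init e.1 = A.fullFCA.init e.2) ↔
      ∀ e ∈ E, A.termOp e.1 = A.termOp e.2 := by rw [termOp_eq_init]
  exact h.symm

theorem mem_up_iff {K : Set (TAlg τ)} {C : CloneAlg τ} :
    C ∈ up K ↔ ∃ A ∈ K, ∃ f, CloneAlg.IsHom C A.fullFCA f ∧ Function.Injective f := by
  constructor
  · rintro ⟨A, hA, F, h⟩
    obtain ⟨g, hg, hb⟩ := h.symm
    exact ⟨A, hA, _, F.isHom_val.comp hg, Subtype.val_injective.comp hb.1⟩
  · rintro ⟨A, hA, f, hf, hi⟩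
    refine ⟨A, hA, hf.range, Iso.symm ⟨_, hf.isHom_rangeFactorization, ?_,
      Set.rangeFactorization_surjective⟩⟩
    exact fun x y h => hi (congrArg Subtype.val h)

theorem fullFCA_mem_up {K : Set (TAlg τ)} {A : TAlg τ} (hA : A ∈ K) : A.fullFCA ∈ up K :=
  mem_up_iff.mpr ⟨A, hA, _, CloneAlg.IsHom.id _, Function.injective_id⟩

/-- Identities descend to embedded algebras. Conversely, a model `C` maps into `C.repr.fullFCA`, so
its identities hold there and `C.repr` is the required value domain. -/
theorem up_Mod (E : Set ((tTerms τ).carrier × (tTerms τ).carrier)) : up (Mod E) = models E := by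
  ext C
  rw [mem_up_iff]
  constructor
  · rintro ⟨A, hA, f, hf, hi⟩
    exact models_of_injective (mem_Mod_iff.mp hA) hf hi
  · intro hC
    exact ⟨C.repr, mem_Mod_iff.mpr (models_of_hom hC C.isHom_threadOp), _, C.isHom_threadOp,
      C.threadOp_injective⟩

theorem down_models (E : Set ((tTerms τ).carrier × (tTerms τ).carrier)) :
    down (models E) ⊆ Mod E := fun _ ⟨F, hF⟩ => mem_Mod_iff.mpr (models_of_hom hF F.isHom_val)

theorem downRich_subset_down (V : Set (CloneAlg τ)) : downRich V ⊆ down V :=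
  fun _ ⟨F, _, hF⟩ => ⟨F, hF⟩

theorem isRich_of_constOp_mem {A : TAlg τ} {F : A.fullFCA.Sub} (h : ∀ b, A.constOp b ∈ F.univ) :
    IsRich F := fun _ hx => hx F (Set.range_subset_iff.mpr h)

theorem mem_downRich_of_fullFCA_mem {V : Set (CloneAlg τ)} (hV : CloneAlg.IsVariety V) {A : TAlg τ}
    (hA : A.fullFCA ∈ V) : A ∈ downRich V :=
  ⟨A.fullFCA.topSub, isRich_of_constOp_mem fun _ => ⟨_, rfl⟩, hV.2.1 _ hA _⟩

/-- If the full functional clone algebras over `K` belong to a variety `V` and `K` contains all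
value domains of rich functional clone algebras in `V`, then `K` is a t-variety. -/
theorem isTVariety_of_downRich {V : Set (CloneAlg τ)} (hV : CloneAlg.IsVariety V)
    {K : Set (TAlg τ)} (hK : ∀ A ∈ K, A.fullFCA ∈ V) (hKV : downRich V ⊆ K) : IsTVariety K := by
  refine ⟨fun A hA B f hf => ?_, fun A hA B => ?_, fun J A hA => ?_⟩
  · obtain ⟨⟨hT, hop⟩, hs, ht⟩ := hf
    refine hKV (mem_downRich_of_fullFCA_mem hV (hV.of_rel (hK A hA)
      -- Operations intertwined by `f`: surjectivity on threads makes the relation functional,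
      -- surjectivity on elements makes it onto.
      (fun φ ψ => ∀ s : A.trace, f (φ s) = ψ ⟨f ∘ s.1, hT s.1 s.2⟩)
      ?_ (fun _ _ => rfl) hop ?_ ?_))
    · intro n φ φ' ψ ψ' h h' s
      refine (h _).trans ?_
      show φ' _ = φ' _
      congr 1
      apply Subtype.ext
      funext i
      by_cases hi : i < n <;> simp [splice, hi, h']
    · intro φ ψ ψ' h h'
      funext r
      obtain ⟨s, hs, e⟩ := ht r.1 r.2
      obtain rfl : r = ⟨f ∘ s, hT s hs⟩ := Subtype.ext e.symm
      exact (h ⟨s, hs⟩).symm.trans (h' ⟨s, hs⟩)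
    · intro ψ
      choose g hg using hs
      exact ⟨fun s => g (ψ ⟨f ∘ s.1, hT s.1 s.2⟩), fun s => hg _⟩
  · refine hKV (mem_downRich_of_fullFCA_mem hV (hV.of_rel (hK A hA)
      (fun φ ψ => ∀ s : B.trace, φ ⟨_, B.trace_sub s.1 s.2⟩ = (ψ s : B.univ).1)
      ?_ (fun _ _ => rfl) (fun _ _ => rfl) ?_ ?_))
    · intro n φ φ' ψ ψ' h h' s
      refine Eq.trans ?_ (h ⟨splice s.1 fun i => ψ' i s, B.isTrace.splice_mem s.2 _⟩)
      show φ _ = φ _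
      congr 1
      apply Subtype.ext
      funext i
      by_cases hi : i < n <;> simp [splice, hi, h']
    · intro φ ψ ψ' h h'
      funext s
      exact Subtype.ext ((h s).symm.trans (h' s))
    · intro ψ
      classical
      -- An operation of the t-subalgebra is extended arbitrarily, here by the first entry, to the
      -- threads outside its trace.
      refine ⟨fun s => if h : ∃ r : B.trace, (fun i => (r.1 i).1) = s.1 then (ψ h.choose : B.univ).1
        else s.1 0, fun s => ?_⟩
      have h : ∃ r : B.trace, (fun i => (r.1 i).1) = (fun i => (s.1 i).1) := ⟨s, rfl⟩
      have hs : h.choose = s := by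
        apply Subtype.ext
        funext i
        exact Subtype.ext (congrFun h.choose_spec i)
      simp only
      rw [dif_pos h, hs]
  · let g : (CloneAlg.prod fun j => (A j).fullFCA).carrier → (prod A).fullFCA.carrier :=
      fun φ s j => φ j ⟨fun k => s.1 k j, s.2 j⟩
    have hg : CloneAlg.IsHom _ _ g := by
      refine ⟨fun n x y => ?_, fun i => rfl, fun σ => rfl⟩
      funext s j
      show x j _ = x j _
      congr 1
      apply Subtype.ext
      funext i
      by_cases hi : i < n
      · simp only [splice, hi, dite_true]; rfl
      · simp only [splice, hi, dite_false]
    -- Operations in the image act coordinatewise, so the image need not be the full functional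
    -- clone algebra; it does contain all constants, and richness is enough.
    exact hKV ⟨hg.range, isRich_of_constOp_mem fun b => ⟨fun j => (A j).constOp (b j), rfl⟩,
      hV.1 _ (hV.2.2 _ _ fun j => hK _ (hA j)) _ _ hg.isHom_rangeFactorization
        Set.rangeFactorization_surjective⟩

end TAlg

/-! ### Hyperterms, weak satisfaction and closure of equational classes. -/

namespace TAlg

variable {τ X : Type u}

open Classical in
/-- Value of a hyperterm at a thread of the trace, where `γ` gives the t-operations for `X`. The last
branch never occurs. -/
noncomputable def hyperEval (A : TAlg τ) (γ : X → A.trace → A.carrier) (s : A.trace) :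
    HTree τ X → A.carrier
  | .e i => s.1 i
  | .app w a => if h : (fun i => A.hyperEval γ s (a i)) ∈ A.trace then
      Sum.elim A.op γ w ⟨_, h⟩ else s.1 0

theorem hyperEval_splice (A : TAlg τ) (γ : X → A.trace → A.carrier) (s : A.trace) {n : ℕ}
    (t : Fin n → HTree τ X) :
    (fun i => A.hyperEval γ s (splice HTree.e t i)) =
      splice s.1 (fun i => A.hyperEval γ s (t i)) := by
  funext i
  simp only [splice]
  split_ifs <;> simp [hyperEval]

theorem hyperEval_app (A : TAlg τ) (γ : X → A.trace → A.carrier) (s : A.trace) (w : τ ⊕ X)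
    (a : ℕ → HTree τ X) (r : A.trace) (h : (fun i => A.hyperEval γ s (a i)) = r.1) :
    A.hyperEval γ s (.app w a) = Sum.elim A.op γ w r := by
  obtain ⟨r, hr⟩ := r
  subst h
  rw [hyperEval, dif_pos hr]

theorem hyperEval_subst (A : TAlg τ) (γ : X → A.trace → A.carrier) (s : A.trace) {n : ℕ}
    (y : Fin n → HTree τ X) {x : HTree τ X} (hx : x.IsHyperterm) :
    A.hyperEval γ s (x.subst y) = A.hyperEval γ
      ⟨splice s.1 (fun i => A.hyperEval γ s (y i)), A.isTrace.splice_mem s.2 _⟩ x := by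
  induction hx with
  | e i => exact congrFun (hyperEval_splice A γ s y) i
  | app w k t _ ih =>
    set s' : A.trace := ⟨splice s.1 (fun i => A.hyperEval γ s (y i)), A.isTrace.splice_mem s.2 _⟩
    rw [A.hyperEval_app γ s' w _ ⟨_, A.isTrace.splice_mem s'.2 fun i => A.hyperEval γ s' (t i)⟩
      (hyperEval_splice A γ s' t)]
    refine A.hyperEval_app γ s w _ _ ?_
    funext i
    by_cases h1 : i < k
    · simpa [splice, h1] using ih ⟨i, h1⟩
    · simpa [splice, h1, HTree.subst, s'] using congrFun (hyperEval_splice A γ s y) i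

/-- Every choice of constants for `X` extends to a weak homomorphism. -/
theorem exists_isHom_constOp (A : TAlg τ) (b : X → A.carrier) :
    ∃ α, CloneAlg.IsHom (hyperterms τ X) A.fullFCA α ∧
      ∀ x, α (hypervar τ x) = A.constOp (b x) := by
  let γ : X → A.trace → A.carrier := fun x _ => b x
  have hsymb : ∀ (w : τ ⊕ X) (s : A.trace),
      A.hyperEval γ s (.app w (splice HTree.e Fin.elim0)) = Sum.elim A.op γ w s := fun w s => by
    refine A.hyperEval_app _ s w _ s ?_
    rw [hyperEval_splice]
    funext i
    simp [splice]
  refine ⟨fun t s => A.hyperEval γ s t.1, ⟨fun n x y => ?_, fun i => ?_,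
    fun σ => ?_⟩, fun x => ?_⟩
  · funext s
    exact hyperEval_subst A _ s _ x.2
  · funext s
    show A.hyperEval γ s (.e i) = s.1 i
    rw [hyperEval]
  · funext s
    exact hsymb (.inl σ) s
  · funext s
    exact hsymb (.inr x) s

/-- t-homomorphisms commute with the values of hyperterms. -/
theorem IsHom.map_hyperterm {A B : TAlg τ} {f : A.carrier → B.carrier} (hf : IsHom A B f)
    {α : (hyperterms τ X).carrier → A.fullFCA.carrier}
    {β : (hyperterms τ X).carrier → B.fullFCA.carrier}
    (hα : CloneAlg.IsHom _ _ α) (hβ : CloneAlg.IsHom _ _ β)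
    (hX : ∀ (x : X) (s : A.trace),
      f (α (hypervar τ x) s) = β (hypervar τ x) ⟨f ∘ s.1, hf.fst s.1 s.2⟩)
    (t : (hyperterms τ X).carrier) (s : A.trace) :
    f (α t s) = β t ⟨f ∘ s.1, hf.fst s.1 s.2⟩ := by
  refine hyperterms_induction
    (P := fun t => ∀ s : A.trace, f (α t s) = β t ⟨f ∘ s.1, hf.fst s.1 s.2⟩)
    (fun i s => ?_) (fun σ s => ?_) hX (fun n t u ht hu s => ?_) t s
  · rw [hα.map_e, hβ.map_e]
    rfl
  · rw [hα.map_cst, hβ.map_cst]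
    exact hf.snd σ s
  · rw [hα.map_q, hβ.map_q]
    refine (ht _).trans ?_
    show β t _ = β t _
    congr 1
    apply Subtype.ext
    funext i
    by_cases hi : i < n <;> simp [splice, hi, hu]

theorem IsHom.map_termOp {A B : TAlg τ} {f : A.carrier → B.carrier} (hf : IsHom A B f)
    (t : (tTerms τ).carrier) (s : A.trace) :
    f (A.termOp t s) = B.termOp t ⟨f ∘ s.1, hf.fst s.1 s.2⟩ :=
  hf.map_hyperterm A.termOp_isHom B.termOp_isHom (fun x => x.elim) t s

theorem Sub.isHom_val {A : TAlg τ} (B : A.Sub) :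
    IsHom B.toAlg A (Subtype.val : B.univ → A.carrier) :=
  ⟨B.trace_sub, fun _ _ => rfl⟩

theorem isHom_proj {J : Type u} (A : J → TAlg τ) (j : J) :
    IsHom (prod A) (A j) (fun x => x j) :=
  ⟨fun _ hs => hs j, fun _ _ => rfl⟩

theorem isHom_restrict (A : TAlg τ) (b : Set (ℕ → A.carrier)) (hb : IsTrace b) (h : b ⊆ A.trace) :
    IsHom (A.restrict b hb h) A id :=
  ⟨fun _ hs => h hs, fun _ _ => rfl⟩

/-- A weak homomorphism into the new algebra is compared with one into a given member, whose
constants are obtained by lifting along `f`, by inclusion, or by projection. This is possible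
because constants, unlike arbitrary t-operations, transfer in all three cases. -/
theorem isTVariety_ModW (E : Set ((hyperterms τ X).carrier × (hyperterms τ X).carrier)) :
    IsTVariety (ModW E) := by
  refine ⟨fun A hA B f hf e he β hβ => ?_, fun A hA B e he β hβ => ?_,
    fun J A hA e he β hβ => ?_⟩
  · obtain ⟨hf, hs, ht⟩ := hf
    obtain ⟨hβ, hX⟩ := hβ
    choose b hb using hX
    choose g hg using hs
    obtain ⟨α, hα, hαX⟩ := A.exists_isHom_constOp fun x => g (b x)
    have key := hf.map_hyperterm hα hβ fun x s => by
      rw [hαX, hb]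
      exact hg _
    funext r
    obtain ⟨s, hs, e⟩ := ht r.1 r.2
    obtain rfl : r = ⟨f ∘ s, hf.fst s hs⟩ := Subtype.ext e.symm
    rw [← key _ ⟨s, hs⟩, ← key _ ⟨s, hs⟩, hA he α ⟨hα, fun x => ⟨_, hαX x⟩⟩]
  · obtain ⟨hβ, hX⟩ := hβ
    choose b hb using hX
    obtain ⟨α, hα, hαX⟩ := A.exists_isHom_constOp fun x => (b x : B.univ).1
    have key := B.isHom_val.map_hyperterm hβ hα fun x s => by
      rw [hαX, hb]
      rfl
    funext s
    apply Subtype.ext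
    rw [key, key, hA he α ⟨hα, fun x => ⟨_, hαX x⟩⟩]
  · obtain ⟨hβ, hX⟩ := hβ
    choose b hb using hX
    funext s j
    obtain ⟨α, hα, hαX⟩ := (A j).exists_isHom_constOp fun x => b x j
    have key := (isHom_proj A j).map_hyperterm hβ hα fun x s => by
      rw [hαX, hb]
      rfl
    rw [key, key, hA j he α ⟨hα, fun x => ⟨_, hαX x⟩⟩]

/-- Over the empty set of hypervariables, the only weak homomorphism is `termOp`. -/
theorem Mod_eq_ModW (E : Set ((tTerms τ).carrier × (tTerms τ).carrier)) : Mod E = ModW E := by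
  ext A
  constructor
  · intro hA e he α hα
    rw [CloneAlg.eq_init hα.1, ← termOp_eq_init]
    exact hA he
  · intro hA e he
    exact hA he A.termOp ⟨A.termOp_isHom, fun x => x.elim⟩

theorem isEtVariety_Mod (E : Set ((tTerms τ).carrier × (tTerms τ).carrier)) :
    IsEtVariety (Mod E) := by
  refine ⟨Mod_eq_ModW E ▸ isTVariety_ModW E, fun A hA e he => ?_⟩
  funext s
  -- The thread `s` lives in the t-subalgebra it generates, its entries being the values of the
  -- projections; terms are therefore evaluated at `s` inside it.
  let s' : (A.gen s).toAlg.trace :=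
    ⟨fun i => ⟨s.1 i, (tTerms τ).e i, congrFun (A.termOp_isHom.map_e i) s⟩, ThreadEquiv.refl _⟩
  have h : ∀ t, _ = A.termOp t s := fun t => (A.gen s).isHom_val.map_termOp t s'
  rw [← h, ← h]
  exact congrArg Subtype.val (congrFun (hA s he) s')

theorem isFtVariety_Mod (E : Set ((tTerms τ).carrier × (tTerms τ).carrier)) :
    IsFtVariety (Mod E) := by
  refine ⟨Mod_eq_ModW E ▸ isTVariety_ModW E, fun A hA e he => ?_⟩
  funext s
  have hd : {r | ThreadEquiv r s.1} ∈ basicParts A.trace :=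
    ⟨⟨s.1, rfl⟩, fun r hr => A.isTrace s.1 s.2 r hr⟩
  have h := (A.isHom_restrict _ hd.1.isTrace hd.2).map_termOp
  exact (h e.1 ⟨s.1, ThreadEquiv.refl _⟩).symm.trans
    ((congrFun (hA _ hd he) _).trans (h e.2 ⟨s.1, ThreadEquiv.refl _⟩))

/-- A class that is defined by identities is defined by the hyperidentities that it weakly
satisfies. -/
theorem eq_ModW_of_eq_Mod {K : Set (TAlg τ)} (hK : K = Mod (classTheory K)) (X : Type u) :
    K = ModW (classWTheory K X) := by
  refine Set.Subset.antisymm (fun A hA e he => he A hA) fun A hA => ?_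
  rw [hK]
  intro e he
  have hι := (hyperterms τ X).isHom_init
  have hmem : ((hyperterms τ X).init e.1, (hyperterms τ X).init e.2) ∈ classWTheory K X := by
    intro B hB α hα
    rw [hα.1.map_init, hα.1.map_init, ← termOp_eq_init]
    exact he B hB
  funext s
  -- Some weak homomorphism must exist for the hyperidentity to have content; the thread `s`
  -- supplies a constant. With an empty trace there is nothing to prove.
  obtain ⟨α, hα, hX⟩ := A.exists_isHom_constOp fun _ : X => s.1 0
  have := hA hmem α ⟨hα, fun x => ⟨_, hX x⟩⟩
  rw [hα.map_init, hα.map_init, ← termOp_eq_init] at this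
  exact congrFun this s

end TAlg

/-! ### Birkhoff's theorem for algebras of a finitary type. -/

namespace RhoAlg

variable {ρ : ℕ → Type u}

/-- Renaming of variables. -/
def _root_.RhoTerm.rename (g : ℕ → ℕ) : RhoTerm ρ → RhoTerm ρ
  | .var i => .var (g i)
  | .app n σ t => .app n σ (fun i => (t i).rename g)

theorem eval_rename (S : RhoAlg ρ) (g : ℕ → ℕ) (v : ℕ → S.carrier) (t : RhoTerm ρ) :
    S.eval v (t.rename g) = S.eval (v ∘ g) t := by
  induction t with
  | var i => rfl
  | app n σ t ih => simp only [RhoTerm.rename, eval, ih]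

theorem IsHom.map_eval {S T : RhoAlg ρ} {f : S.carrier → T.carrier} (hf : IsHom S T f)
    (v : ℕ → S.carrier) (t : RhoTerm ρ) : f (S.eval v t) = T.eval (f ∘ v) t := by
  induction t with
  | var i => rfl
  | app n σ t ih => simp only [eval, hf n σ, ih]

theorem isHom_proj {J : Type u} (S : J → RhoAlg ρ) (j : J) : IsHom (prod S) (S j) (fun x => x j) :=
  fun _ _ _ => rfl

/-- If two terms with variables from `S` have the same value for all assignments in members of `H`,
then they have the same value in every model of the theory of `H`. -/
theorem eval_eq_of_forall {H : Set (RhoAlg ρ)} {S : RhoAlg ρ} (hS : S ∈ Mod (Th H))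
    (x : ℕ → S.carrier) (t u : RhoTerm ρ)
    (h : ∀ A ∈ H, ∀ v : S.carrier → A.carrier, A.eval (v ∘ x) t = A.eval (v ∘ x) u) :
    S.eval x t = S.eval x u := by
  -- Variables with equal value under `x` are merged, so that every assignment of the merged
  -- variables factors through `S.carrier`.
  let m : ℕ → ℕ := fun i => Function.invFun x (x i)
  have hm : x ∘ m = x := funext fun i => Function.invFun_eq ⟨i, rfl⟩
  have hTh : (t.rename m, u.rename m) ∈ Th H := by
    intro A hA v
    show A.eval v (t.rename m) = A.eval v (u.rename m)
    rw [eval_rename, eval_rename]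
    exact h A hA (v ∘ Function.invFun x)
  have := hS _ hTh x
  simpa only [eval_rename, hm] using this

/-- Finitely many pairs of a term and an assignment can be given a common assignment. -/
theorem exists_common_assignment {S : Type u} (s₀ : S) {n : ℕ} (t : Fin n → RhoTerm ρ)
    (x : Fin n → ℕ → S) : ∃ (t' : Fin n → RhoTerm ρ) (z : ℕ → S),
      ∀ (A : RhoAlg ρ) (v : S → A.carrier) i, A.eval (v ∘ z) (t' i) = A.eval (v ∘ x i) (t i) := by
  -- The pairing function makes the variables of different terms disjoint; `s₀` fills the indices
  -- that are never used.
  refine ⟨fun i => (t i).rename (Nat.pair i), fun k => if h : k.unpair.1 < n then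
    x ⟨_, h⟩ k.unpair.2 else s₀, fun A v i => ?_⟩
  rw [eval_rename]
  congr 1
  funext k
  simp

/-- Birkhoff's theorem. -/
theorem IsVariety.eq_Mod_Th {H : Set (RhoAlg ρ)} (hH : IsVariety H) : H = Mod (Th H) := by
  refine Set.Subset.antisymm (fun S hS e he => he S hS) fun S hS => ?_
  obtain ⟨s₀⟩ := S.nonempty
  -- One separating member of `H` for each failing equation between terms with variables from `S`.
  -- In their product, the elements `w a` generate a copy of the relatively free algebra over the
  -- set `S.carrier`.
  let J := {p : RhoTerm ρ × RhoTerm ρ × (ℕ → S.carrier) // ∃ A ∈ H, ∃ v : S.carrier → A.carrier,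
    A.eval (v ∘ p.2.2) p.1 ≠ A.eval (v ∘ p.2.2) p.2.1}
  choose A hA v hv using fun p : J => p.2
  let P := prod A
  let w : S.carrier → P.carrier := fun a j => v j a
  have hP : P ∈ H := hH.2.2 J A hA
  have hsep : ∀ x t u, P.eval (w ∘ x) t = P.eval (w ∘ x) u → S.eval x t = S.eval x u := by
    intro x t u h
    refine eval_eq_of_forall hS x t u ?_
    by_contra! hne
    let p : J := ⟨(t, u, x), hne⟩
    apply hv p
    have := congrFun h p
    exact ((isHom_proj A p).map_eval (w ∘ x) t).symm.trans
      (this.trans ((isHom_proj A p).map_eval (w ∘ x) u))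
  have hsep' : ∀ x t y u, P.eval (w ∘ x) t = P.eval (w ∘ y) u → S.eval x t = S.eval y u := by
    intro x t y u h
    obtain ⟨t', z, hz⟩ := exists_common_assignment s₀ ![t, u] ![x, y]
    have h0 := fun (B : RhoAlg ρ) v => hz B v 0
    have h1 := fun (B : RhoAlg ρ) v => hz B v 1
    have := hsep z (t' 0) (t' 1) (((h0 P w).trans h).trans (h1 P w).symm)
    exact (h0 S id).symm.trans (this.trans (h1 S id))
  let R : P.Sub :=
    { univ := {a | ∃ t x, P.eval (w ∘ x) t = a}
      nonempty := ⟨_, .var 0, fun _ => s₀, rfl⟩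
      op_mem := by
        intro n σ a ha
        choose t x h using ha
        obtain ⟨t', z, hz⟩ := exists_common_assignment s₀ t x
        refine ⟨.app n σ t', z, ?_⟩
        simp only [eval, hz, h] }
  choose t x htx using fun a : R.univ => a.2
  -- The canonical map sends the generator `w a` to `a`; by `hsep'` it does not depend on the chosen
  -- term and assignment.
  refine hH.1 _ (hH.2.1 P hP R) S (fun a => S.eval (x a) (t a)) (fun n σ a => ?_) fun a => ?_
  · obtain ⟨t', z, hz⟩ := exists_common_assignment s₀ (fun i => t (a i)) (fun i => x (a i))
    have : S.op n σ (fun i => S.eval (x (a i)) (t (a i))) = S.eval z (.app n σ t') := by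
      simp only [eval]
      congr 1
      exact funext fun i => (hz S id i).symm
    rw [this]
    apply hsep'
    refine (htx (R.toAlg.op n σ a)).trans ?_
    simp only [eval, hz]
    exact congrArg (P.op n σ) (funext fun i => (htx (a i)).symm)
  · refine ⟨⟨w a, .var 0, fun _ => a, rfl⟩, ?_⟩
    exact hsep' _ _ (fun _ => a) (.var 0) (htx _)

/-- The value of a term depends on finitely many variables only. -/
theorem exists_eval_congr (S : RhoAlg ρ) (t : RhoTerm ρ) :
    ∃ n, ∀ v v' : ℕ → S.carrier, (∀ i < n, v i = v' i) → S.eval v t = S.eval v' t := by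
  induction t with
  | var i => exact ⟨i + 1, fun v v' h => h i (Nat.lt_succ_self i)⟩
  | app n σ t ih =>
    choose m hm using ih
    refine ⟨Finset.univ.sup m, fun v v' h => ?_⟩
    simp only [eval]
    congr 1
    funext i
    exact hm i v v' fun k hk => h k (hk.trans_le (Finset.le_sup (Finset.mem_univ i)))

end RhoAlg

/-! ### Dimension and dependence on coordinates. -/

namespace TAlg

/-- Independence lets entry `k` be overwritten by entry `k + 1` in both threads, after which they
coincide. -/
theorem indep_congr {τ : Type u} {A : TAlg τ} {φ : A.fullFCA.carrier} {k : ℕ}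
    (h : A.fullFCA.Indep φ k) (s r : A.trace) (hsr : ∀ i, i ≠ k → s.1 i = r.1 i) : φ s = φ r := by
  rw [← congrFun h s, ← congrFun h r]
  show φ _ = φ _
  congr 1
  apply Subtype.ext
  funext i
  by_cases h1 : i < k + 1
  · by_cases h2 : i < k
    · simpa [splice, h1, h2] using! hsr i (by omega)
    · simpa [splice, h1, h2] using! hsr (k + 1) (by omega)
  · simpa [splice, h1] using hsr i (by omega)

theorem indep_of_congr {τ : Type u} {A : TAlg τ} {φ : A.fullFCA.carrier} {k : ℕ}
    (h : ∀ s r : A.trace, ThreadEquiv s.1 r.1 → (∀ i < k, s.1 i = r.1 i) → φ s = φ r) :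
    A.fullFCA.Indep φ k := by
  funext s
  refine h _ s (splice_equiv s.1 fun i : Fin (k + 1) =>
    (if i.1 < k then A.fullFCA.e i else A.fullFCA.e (k + 1)) s) fun i hi => ?_
  have : i < k + 1 := by omega
  simp only [splice, this, dite_true, hi, if_true]
  rfl

theorem congr_of_indep {τ : Type u} {A : TAlg τ} {φ : A.fullFCA.carrier} {n : ℕ}
    (h : ∀ k, n ≤ k → A.fullFCA.Indep φ k) (s r : A.trace) (hsr : ThreadEquiv s.1 r.1)
    (hn : ∀ i < n, s.1 i = r.1 i) : φ s = φ r := by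
  -- Equivalent threads agree from some `m` on; the entries below `m` are corrected one at a time,
  -- from the top down.
  have key : ∀ (m : ℕ) (s r : A.trace), (∀ i, i < n ∨ m ≤ i → s.1 i = r.1 i) → φ s = φ r := by
    intro m
    induction m with
    | zero =>
      intro s r h
      congr 1
      exact Subtype.ext (funext fun i => h i (Or.inr (Nat.zero_le i)))
    | succ m ih =>
      intro s r hs
      let t : ℕ → A.carrier := Function.update s.1 m (r.1 m)
      have ht : t ∈ A.trace := by
        refine A.isTrace s.1 s.2 t ((Set.finite_singleton m).subset fun i hi => ?_)
        by_contra him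
        exact hi (Function.update_of_ne him _ _)
      have hst : φ s = φ ⟨t, ht⟩ := by
        rcases le_or_gt n m with hm | hm
        · exact indep_congr (h m hm) s ⟨t, ht⟩ fun i hi => (Function.update_of_ne hi _ _).symm
        · congr 1
          apply Subtype.ext
          exact (Function.update_eq_self_iff.mpr (hs m (Or.inl hm)).symm).symm
      refine hst.trans (ih ⟨t, ht⟩ r fun i hi => ?_)
      by_cases him : i = m
      · subst him
        simp [t]
      · exact (Function.update_of_ne him _ _).trans (hs i (hi.imp_right fun h => by omega))
  obtain ⟨m, hm⟩ := (show Set.Finite _ from hsr).bddAbove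
  refine key (m + 1) s r fun i hi => hi.elim (hn i) fun hi => ?_
  by_contra hne
  exact absurd (hm hne) (by omega)

end TAlg

/-- Index `k` contributes `k + 1` to the dimension, so the bound `n` already excludes dependence at
`k = n`. -/
theorem CloneAlg.dim_le_iff {τ : Type u} (C : CloneAlg τ) (a : C.carrier) (n : ℕ) :
    C.dim a ≤ n ↔ ∀ k, n ≤ k → C.Indep a k := by
  simp only [CloneAlg.dim, iSup_le_iff, Set.mem_ofPred_eq, Nat.cast_le]
  constructor
  · intro h k hk
    by_contra hd
    have := h k hd
    omega
  · intro h k hd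
    by_contra hk
    exact hd (h k (by omega))

/-! ### The class of t-algebras glued from `H`. -/

namespace TAlg

variable {ρ : ℕ → Type u}

/-- On the class of the thread `s` the operations of `A` are those of `S`. -/
def AgreesAt (A : TAlg (starType ρ)) (S : RhoStr ρ A.carrier) (s : A.trace) : Prop :=
  ∀ (n : ℕ) (σ : ρ n) (r : A.trace), ThreadEquiv r.1 s.1 → A.op ⟨n, σ⟩ r = S n σ (fun i => r.1 i)

/-- Independence only compares equivalent threads, and on one class the operation reads just its
first `n` entries. The dimension condition is thus automatic, and membership in `starClass H` can be
tested thread by thread. -/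
theorem isRhoDimensional_of_agreesAt {A : TAlg (starType ρ)}
    (h : ∀ s : A.trace, ∃ S, A.AgreesAt S s) : IsRhoDimensional A := fun n σ => by
  refine (CloneAlg.dim_le_iff _ _ _).mpr fun k hk => ?_
  refine indep_of_congr fun s r hsr heq => ?_
  obtain ⟨S, hS⟩ := h r
  rw [hS n σ s hsr, hS n σ r (ThreadEquiv.refl _)]
  congr 1
  exact funext fun i => heq i (i.2.trans_le hk)

theorem mem_starClass_iff {H : Set (RhoAlg ρ)} {A : TAlg (starType ρ)} :
    A ∈ starClass H ↔ ∀ s : A.trace, ∃ S, ⟨A.carrier, ⟨s.1 0⟩, S⟩ ∈ H ∧ A.AgreesAt S s := by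
  constructor
  · rintro ⟨-, h⟩ s
    obtain ⟨hA, S, hS, hop⟩ := h {r | ThreadEquiv r s.1}
      ⟨⟨s.1, rfl⟩, fun r hr => A.isTrace s.1 s.2 r hr⟩
    exact ⟨S, hS, fun n σ r hr => hop n σ ⟨r.1, hr⟩⟩
  · intro h
    refine ⟨isRhoDimensional_of_agreesAt fun s => (h s).imp fun _ hS => hS.2, ?_⟩
    rintro _ ⟨⟨s, rfl⟩, hsub⟩
    obtain ⟨S, hS, hop⟩ := h ⟨s, hsub (ThreadEquiv.refl s)⟩
    exact ⟨⟨s 0⟩, S, hS, fun n σ r => hop n σ ⟨r.1, hsub r.2⟩ r.2⟩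

/-- The translation of `ρ`-terms into terms of clone algebras. -/
noncomputable def ofRhoTerm : RhoTerm ρ → (tTerms (starType ρ)).carrier
  | .var i => (tTerms (starType ρ)).e i
  | .app n σ t => (tTerms (starType ρ)).q n ((tTerms (starType ρ)).cst ⟨n, σ⟩)
      (fun i => ofRhoTerm (t i))

theorem AgreesAt.termOp_ofRhoTerm {A : TAlg (starType ρ)} {S : RhoStr ρ A.carrier} {s : A.trace}
    (h : A.AgreesAt S s) (hA : Nonempty A.carrier) (t : RhoTerm ρ) (r : A.trace)
    (hr : ThreadEquiv r.1 s.1) :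
    A.termOp (ofRhoTerm t) r = RhoAlg.eval ⟨A.carrier, hA, S⟩ r.1 t := by
  induction t with
  | var i => rw [ofRhoTerm, A.termOp_isHom.map_e]; rfl
  | app n σ t ih =>
    rw [ofRhoTerm, A.termOp_isHom.map_q, A.termOp_isHom.map_cst]
    refine (h n σ ⟨_, A.isTrace.splice_mem r.2 _⟩ ((splice_equiv _ _).trans hr)).trans ?_
    rw [RhoAlg.eval]
    show S n σ _ = S n σ _
    congr 1
    funext i
    rw [← ih i]
    simp [splice]

/-- Two kinds of identities suffice: those expressing independence make the operations finitary on
each class, and the translated members of `Th H` put the resulting `ρ`-algebra into `H`. -/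
theorem starClass_eq_Mod {H : Set (RhoAlg ρ)} (hH : H = RhoAlg.Mod (RhoAlg.Th H)) :
    starClass H = Mod (classTheory (starClass H)) := by
  refine Set.Subset.antisymm (fun A hA e he => he A hA) fun A hA => ?_
  have hindep : ∀ n (σ : ρ n) k, n ≤ k → A.fullFCA.Indep (A.op ⟨n, σ⟩) k := by
    intro n σ k hk
    let T := tTerms (starType ρ)
    have hiff : ∀ B : TAlg (starType ρ),
        B.termOp (T.q (k + 1) (T.cst ⟨n, σ⟩)
          (fun i => if i.1 < k then T.e i else T.e (k + 1))) = B.termOp (T.cst ⟨n, σ⟩) ↔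
        B.fullFCA.Indep (B.op ⟨n, σ⟩) k := by
      intro B
      rw [B.termOp_isHom.map_q, B.termOp_isHom.map_cst]
      simp only [apply_ite B.termOp, T, B.termOp_isHom.map_e]
      rfl
    refine (hiff A).mp (hA (a := (_, _)) fun B hB => (hiff B).mpr ?_)
    exact ((CloneAlg.dim_le_iff _ _ _).mp (hB.1 n σ)) k hk
  rw [mem_starClass_iff]
  intro s
  -- The tail of `s` fills the irrelevant places, which keeps the thread in the trace.
  let S : RhoStr ρ A.carrier := fun n σ x => A.op ⟨n, σ⟩ ⟨splice s.1 x, A.isTrace.splice_mem s.2 x⟩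
  have hS : A.AgreesAt S s := by
    intro n σ r hr
    refine congr_of_indep (hindep n σ) r _ (hr.trans (splice_equiv s.1 fun i : Fin n => r.1 i).symm) fun i hi => ?_
    simp [splice, hi]
  refine ⟨S, ?_, hS⟩
  rw [hH]
  intro e he v
  let S' : RhoAlg ρ := ⟨A.carrier, ⟨s.1 0⟩, S⟩
  obtain ⟨m₁, hm₁⟩ := S'.exists_eval_congr e.1
  obtain ⟨m₂, hm₂⟩ := S'.exists_eval_congr e.2
  -- The assignment `v` need not belong to the trace; only its first entries matter for the two
  -- terms, so it is replaced by a thread equivalent to `s`.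
  let r : A.trace := ⟨splice s.1 (fun i : Fin (max m₁ m₂) => v i), A.isTrace.splice_mem s.2 _⟩
  have hrs : ThreadEquiv r.1 s.1 := splice_equiv s.1 fun i : Fin (max m₁ m₂) => v i
  have hr : ∀ i < max m₁ m₂, v i = r.1 i := fun i hi => by simp [r, splice, hi]
  have hmem : (ofRhoTerm e.1, ofRhoTerm e.2) ∈ classTheory (starClass H) := by
    intro B hB
    funext b
    obtain ⟨U, hU, hb⟩ := mem_starClass_iff.mp hB b
    show B.termOp _ b = B.termOp _ b
    rw [hb.termOp_ofRhoTerm ⟨b.1 0⟩ _ _ (ThreadEquiv.refl _),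
      hb.termOp_ofRhoTerm ⟨b.1 0⟩ _ _ (ThreadEquiv.refl _)]
    exact he _ hU b.1
  have := congrFun (hA hmem) r
  show S'.eval v e.1 = S'.eval v e.2
  rw [hm₁ v r.1 fun i hi => hr i (lt_max_of_lt_left hi),
    hm₂ v r.1 fun i hi => hr i (lt_max_of_lt_right hi)]
  rw [← hS.termOp_ofRhoTerm ⟨s.1 0⟩ _ r hrs,
    ← hS.termOp_ofRhoTerm ⟨s.1 0⟩ _ r hrs]
  exact this

/-- The t-algebra of all threads over a `ρ`-algebra. -/
def ofRhoAlg (S : RhoAlg ρ) : TAlg (starType ρ) where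
  carrier := S.carrier
  trace := Set.univ
  isTrace _ _ _ _ := trivial
  op σ s := S.op σ.1 σ.2 (fun i => s.1 i)

/-- One basic class already determines the operations, since its threads take arbitrary values in
the first `n` places. Hence `H` can be recovered from `starClass H`. -/
theorem ofRhoAlg_mem_starClass_iff {H : Set (RhoAlg ρ)} {S : RhoAlg ρ} :
    ofRhoAlg S ∈ starClass H ↔ S ∈ H := by
  rw [mem_starClass_iff]
  constructor
  · intro h
    obtain ⟨a⟩ := S.nonempty
    obtain ⟨U, hU, hop⟩ := h ⟨fun _ => a, trivial⟩
    suffices U = S.op by subst this; exact hU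
    funext n σ x
    have := hop n σ ⟨splice (fun _ => a) x, trivial⟩ (splice_equiv _ _)
    have hx : (fun i : Fin n => splice (fun _ => a) x i) = x := by
      funext i
      exact dif_pos i.2
    exact (congrArg (U n σ) hx).symm.trans (this.symm.trans (congrArg (S.op n σ) hx))
  · exact fun hS s => ⟨S.op, hS, fun n σ r _ => rfl⟩

theorem isVariety_of_isTVariety_starClass {H : Set (RhoAlg ρ)} (hK : IsTVariety (starClass H)) :
    RhoAlg.IsVariety H := by
  refine ⟨fun S hS T f hf hs => ?_, fun S hS T => ?_, fun J S hS => ?_⟩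
  · rw [← ofRhoAlg_mem_starClass_iff] at hS ⊢
    refine hK.1 _ hS _ f ⟨⟨fun _ _ => trivial, fun σ s => hf _ _ _⟩, hs, fun r _ => ?_⟩
    choose g hg using hs
    exact ⟨fun i => g (r i), trivial, funext fun i => hg _⟩
  · rw [← ofRhoAlg_mem_starClass_iff] at hS ⊢
    exact hK.2.1 _ hS
      { univ := T.univ
        trace := Set.univ
        isTrace := fun _ _ _ _ => trivial
        trace_sub := fun _ _ => trivial
        op_mem := fun σ s _ => T.op_mem _ _ _ fun i => (s i).2 }
  · rw [← ofRhoAlg_mem_starClass_iff]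
    have h := hK.2.2 J (fun j => ofRhoAlg (S j)) fun j => ofRhoAlg_mem_starClass_iff.mpr (hS j)
    -- The t-product and the t-algebra of the product differ only in how the full trace is
    -- presented, so the identity is an onto t-homomorphism.
    refine hK.1 _ h _ id ⟨⟨fun _ _ => trivial, fun _ _ => rfl⟩, Function.surjective_id, ?_⟩
    exact fun r _ => ⟨r, fun _ => trivial, rfl⟩

end TAlg

/-! ### The cycle of implications. -/

theorem mainTheorem1 {ρ : ℕ → Type u} (H : Set (RhoAlg ρ)) (X : Type u) [Infinite X] :
    List.TFAE [
      RhoAlg.IsVariety H,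
      H = RhoAlg.Mod (RhoAlg.Th H),
      TAlg.IsEtVariety (starClass H),
      starClass H = TAlg.Mod (TAlg.classTheory (starClass H)),
      CloneAlg.IsVariety (TAlg.up (starClass H)) ∧
        starClass H = TAlg.down (TAlg.up (starClass H)),
      TAlg.IsFtVariety (starClass H),
      starClass H = TAlg.ModW (TAlg.classWTheory (starClass H) X),
      CloneAlg.IsVariety (TAlg.up (starClass H)) ∧
        starClass H = TAlg.downRich (TAlg.up (starClass H)),
      TAlg.IsTVariety (starClass H)] := by
  tfae_have 1 → 2 := RhoAlg.IsVariety.eq_Mod_Th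
  tfae_have 2 → 4 := TAlg.starClass_eq_Mod
  tfae_have 4 → 3 := fun h => h ▸ TAlg.isEtVariety_Mod _
  tfae_have 4 → 6 := fun h => h ▸ TAlg.isFtVariety_Mod _
  tfae_have 4 → 7 := fun h => TAlg.eq_ModW_of_eq_Mod h X
  tfae_have 4 → 5 := fun h => by
    have hup := TAlg.up_Mod (TAlg.classTheory (starClass H))
    rw [← h] at hup
    refine ⟨hup ▸ CloneAlg.isVariety_models _, Set.Subset.antisymm (fun A hA => ?_) ?_⟩
    · exact ⟨_, (TAlg.mem_downRich_of_fullFCA_mem (hup ▸ CloneAlg.isVariety_models _)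
        (TAlg.fullFCA_mem_up hA)).choose_spec.2⟩
    · have := TAlg.down_models (TAlg.classTheory (starClass H))
      rwa [← h, ← hup] at this
  -- One inclusion holds because the full functional clone algebra is itself rich, the other because
  -- rich value domains are value domains.
  tfae_have 5 → 8 := fun ⟨hV, h⟩ => ⟨hV, Set.Subset.antisymm
    (fun A hA => TAlg.mem_downRich_of_fullFCA_mem hV (TAlg.fullFCA_mem_up hA))
    ((TAlg.downRich_subset_down _).trans h.ge)⟩
  tfae_have 8 → 9 := fun ⟨hV, h⟩ =>
    TAlg.isTVariety_of_downRich hV (fun A hA => TAlg.fullFCA_mem_up hA) h.ge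
  tfae_have 3 → 9 := fun h => h.1
  tfae_have 6 → 9 := fun h => h.1
  tfae_have 7 → 9 := fun h => h ▸ TAlg.isTVariety_ModW _
  tfae_have 9 → 1 := TAlg.isVariety_of_isTVariety_starClass
  tfae_finish
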